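/- **Proposition (Kusuoka representation).** Let $(\Omega,\mathcal F,P)$ be a probability space, let $\alpha\in[0,1)$, and let either $p>1$ and $Y\in L^p$, or $p<0$ and $Y\in L^\infty$. Put $p'=\frac{p}{p-1}$, so that $p'>1$ if $p>1$ and $0<p'<1$ if $p<0$. A density is a random variable $Z\ge 0$ with $\mathbb E Z=1$. Let $$\mathrm{EVaR}^p_\alpha(Y)=\sup\Big\{\mathbb E YZ:\ Z\text{ a density},\ \mathbb E Z^{p'}<\infty,\ \tfrac{1}{p'-1}\log\mathbb E Z^{p'}\le\log\tfrac1{1-\alpha}\Big\},\tag{1}$$ and for $x\in[0,1)$ let $\mathrm{AVaR}_x(Y)=\sup\{\mathbb E YZ:\ Z\text{ a density},\ Z\le\frac1{1-x}\}$. For a random variable $Z$ and $u\in(0,1)$ let $\mathrm{VaR}_u(Z)=\inf\{x\in\mathbb R:P(Z\le x)\ge u\}$. For a probability measure $\mu$ on $[0,1)$ let $$\sigma_\mu(u)=\int_{[0,u]}\frac{1}{1-v}\,\mu(\mathrm dv)\qquad(0\le u<1).$$ Call $\mu$ admissible if $\int_0^1\sigma_\mu(u)^{p'}\,\mathrm du$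 is finite and $$\int_0^1\sigma_\mu(u)^{p'}\,\mathrm du\le\Big(\frac1{1-\alpha}\Big)^{p'-1}\ \text{ if }p>1,\qquad \int_0^1\sigma_\mu(u)^{p'}\,\mathrm du\ge\Big(\frac1{1-\alpha}\Big)^{p'-1}\ \text{ if }p<0.$$ Then the supremum in (1) is finite, $x\mapsto\mathrm{AVaR}_x(Y)$ is $\mu$-integrable for every admissible $\mu$, and $$\mathrm{EVaR}^p_\alpha(Y)=\sup\Big\{\int_{[0,1)}\mathrm{AVaR}_x(Y)\,\mu(\mathrm dx):\ \mu\text{ admissible}\Big\}.\tag{2}$$ If $p>1$, then the supremum in (1) is attained. Whenever (for $p>1$ or $p<0$) $Z^*$ is a density that attains the supremum in (1), there is exactly one probability measure $\mu$ on $[0,1)$ with $\sigma_{\mu}(u)=\mathrm{VaR}_u(Z^*)$ for almost every $u\in(0,1)$, and this $\mu$ is admissible and attains the supremum in (2). -/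

import Mathlib

open MeasureTheory Set

namespace EntropicRisk

/-- A density with respect to `P`: an integrable `Z ≥ 0` with `E Z = 1`. -/
structure IsDensity {Ω : Type*} [MeasurableSpace Ω] (P : Measure Ω) (Z : Ω → ℝ) : Prop where
  integrable : Integrable Z P
  nonneg : ∀ᵐ ω ∂P, 0 ≤ Z ω
  integral_eq_one : ∫ ω, Z ω ∂P = 1

/-- The Rényi entropy `H_q(Z) = (q - 1)⁻¹ log E Z^q` of a density `Z`,
for an order `q ∈ (0, 1) ∪ (1, ∞)`. -/
noncomputable def renyiEntropy {Ω : Type*} [MeasurableSpace Ω] (P : Measure Ω) (q : ℝ)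
    (Z : Ω → ℝ) : ℝ :=
  1 / (q - 1) * Real.log (∫ ω, Z ω ^ q ∂P)

/-- The densities `Z` with `H_{p'}(Z) ≤ log (1 / (1 - α))`, where `p' = p / (p - 1)`. The entropy is
only defined when `E Z^{p'}` is finite, so this is part of the constraint. -/
structure IsFeasibleDensity {Ω : Type*} [MeasurableSpace Ω] (P : Measure Ω) (p α : ℝ)
    (Z : Ω → ℝ) : Prop where
  isDensity : IsDensity P Z
  integrable_rpow : Integrable (fun ω => Z ω ^ p.conjExponent) P
  entropy_le : renyiEntropy P p.conjExponent Z ≤ Real.log (1 / (1 - α))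

/-- The numbers `E Y Z`, where `Z` ranges over the feasible densities. -/
def evarValues {Ω : Type*} [MeasurableSpace Ω] (P : Measure Ω) (p α : ℝ) (Y : Ω → ℝ) : Set ℝ :=
  {r | ∃ Z : Ω → ℝ, IsFeasibleDensity P p α Z ∧ r = ∫ ω, Y ω * Z ω ∂P}

/-- The Entropic Value-at-Risk of order `p` (with `p > 1` or `p < 0`) at level `α ∈ [0, 1)`. -/
noncomputable def EVaR {Ω : Type*} [MeasurableSpace Ω] (P : Measure Ω) (p α : ℝ)
    (Y : Ω → ℝ) : ℝ :=
  sSup (evarValues P p α Y)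

/-- `Z` is an optimal density in the definition of the Entropic Value-at-Risk of `Y`. -/
def IsOptimalDensity {Ω : Type*} [MeasurableSpace Ω] (P : Measure Ω) (p α : ℝ) (Y : Ω → ℝ)
    (Z : Ω → ℝ) : Prop :=
  IsFeasibleDensity P p α Z ∧ ∫ ω, Y ω * Z ω ∂P = EVaR P p α Y

/-- The Average Value-at-Risk of `Y` at level `x ∈ [0, 1)`. -/
noncomputable def AVaR {Ω : Type*} [MeasurableSpace Ω] (P : Measure Ω) (x : ℝ)
    (Y : Ω → ℝ) : ℝ :=
  sSup {r | ∃ Z : Ω → ℝ, IsDensity P Z ∧ (∀ᵐ ω ∂P, Z ω ≤ 1 / (1 - x)) ∧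
    r = ∫ ω, Y ω * Z ω ∂P}

/-- The Value-at-Risk of `Z` at level `u ∈ (0, 1)`, that is, the generalized inverse
`inf {x | P (Z ≤ x) ≥ u}` of the distribution function of `Z`. -/
noncomputable def VaR {Ω : Type*} [MeasurableSpace Ω] (P : Measure Ω) (u : ℝ)
    (Z : Ω → ℝ) : ℝ :=
  sInf {x : ℝ | u ≤ P.real {ω | Z ω ≤ x}}

/-- A probability measure on `[0, 1)`, regarded as a measure on `ℝ`. -/
structure IsProbOnIco (μ : Measure ℝ) : Prop where
  isProbabilityMeasure : IsProbabilityMeasure μ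
  compl_null : μ (Ico (0 : ℝ) 1)ᶜ = 0

/-- The distortion function `σ_μ(u) = ∫_{[0, u]} (1 - v)⁻¹ μ(dv)`, for `u ∈ [0, 1)`. -/
noncomputable def distortion (μ : Measure ℝ) (u : ℝ) : ℝ :=
  ∫ v in Icc 0 u, 1 / (1 - v) ∂μ

/-- The probability measures on `[0, 1)` admitted in the Kusuoka representation:
`∫₀¹ σ_μ^{p'}` is at most `(1 / (1 - α))^{p' - 1}` if `p > 1` (where `p' > 1`), and at least
`(1 / (1 - α))^{p' - 1}` if `p < 0` (where `0 < p' < 1`). In both cases this is the entropy bound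
`(p' - 1)⁻¹ log ∫₀¹ σ_μ^{p'} ≤ log (1 / (1 - α))`. -/
structure IsAdmissible (p α : ℝ) (μ : Measure ℝ) : Prop where
  isProbOnIco : IsProbOnIco μ
  integrableOn : IntegrableOn (fun u => distortion μ u ^ p.conjExponent) (Ioo 0 1)
  le_of_one_lt : 1 < p →
    ∫ u in Ioo (0 : ℝ) 1, distortion μ u ^ p.conjExponent ≤ (1 / (1 - α)) ^ (p.conjExponent - 1)
  ge_of_neg : p < 0 →
    (1 / (1 - α)) ^ (p.conjExponent - 1) ≤ ∫ u in Ioo (0 : ℝ) 1, distortion μ u ^ p.conjExponent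

/-- `μ` is the probability measure on `[0, 1)` associated with the distortion function
`σ(u) = VaR_u(Z)`: the functions `σ_μ` (right-continuous) and `u ↦ VaR_u(Z)` (left-continuous)
agree at almost every `u ∈ (0, 1)`. -/
def IsAssociated {Ω : Type*} [MeasurableSpace Ω] (P : Measure Ω) (Z : Ω → ℝ)
    (μ : Measure ℝ) : Prop :=
  IsProbOnIco μ ∧ ∀ᵐ u ∂(volume : Measure ℝ), u ∈ Ioo (0 : ℝ) 1 → distortion μ u = VaR P u Z

end EntropicRisk

/-! Write q for the conjugate exponent p' and Q_u for VaR_u(Y). The two inequalities in (2) come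
from passing between densities on Ω and measures on [0, 1); Ω may have atoms.

From measures to densities: splitting Y at Q_x bounds AVaR_x(Y) by (1 - x)⁻¹ ∫_x^1 Q_u du, and
Fubini turns the μ-integral of this bound into ∫ Q_u σ_μ(u) du (`IsProbOnIco.integral_AVaR_le`).
Here σ_μ is a density on (0, 1), where Q has the law of Y. Conditioning σ_μ on Q gives some h(Q),
and Z = h(Y) is a density on Ω with the same pairing. Jensen moves the q-th moment in the direction
that the constraint permits, for q > 1 and for q < 1 (`exists_density_of_density_Ioo`).

From densities to measures: for a feasible Z with distribution function F, let μ be the image of P(Z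
> t) dt under F. The layer-cake formula writes E YZ as ∫_0^∞ E[Y 1_{Z > t}] dt, and the normalized
indicator of {Z > t} competes in AVaR_{F(t)}(Y); so E YZ ≤ ∫ AVaR dμ
(`IsDensity.integral_mul_le_integral_AVaR`). The weight P(Z > t) = 1 - F(t) cancels the kernel of
the distortion, so σ_μ(u) is the length of {t > 0 : F(t) ≤ u}, which is VaR_u(Z) for almost every u
(`IsDensity.isAssociated_associatedMeasure`). Hence σ_μ and Z have equal q-th moments and μ is
admissible; if Z is optimal, so is μ. Uniqueness holds because integration by parts recovers the
distribution function of μ from σ_μ.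

Existence for p > 1 is explicit: Z is proportional to ((Y - c)⁺)^(p - 1), with c found by the
intermediate value theorem so that the entropy constraint is active. If no c reaches the entropy
bound, Y has an atom of mass at least 1 - α at its maximum, whose normalized indicator is optimal.
For α = 0 only Z = 1 is feasible. -/

namespace EntropicRisk

/-! ### Quantile functions and their law -/

section Quantile

variable {Ω : Type*} [MeasurableSpace Ω] {P : Measure Ω} [IsProbabilityMeasure P]

lemma cdf_map_eq {Z : Ω → ℝ} (hZ : AEMeasurable Z P) (t : ℝ) :
    ProbabilityTheory.cdf (P.map Z) t = P.real {ω | Z ω ≤ t} := by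
  have := Measure.isProbabilityMeasure_map hZ
  rw [ProbabilityTheory.cdf_eq_real, map_measureReal_apply_of_aemeasurable hZ measurableSet_Iic]
  rfl

/-- Right-continuity of the distribution function makes the infimum a minimum. This Galois
connection is the only access to `VaR` used below; it needs 0 < u < 1 so that the set is nonempty
and bounded below. -/
lemma VaR_le_iff {Z : Ω → ℝ} (hZ : AEMeasurable Z P) {u t : ℝ} (hu : u ∈ Ioo (0 : ℝ) 1) :
    VaR P u Z ≤ t ↔ u ≤ P.real {ω | Z ω ≤ t} := by
  have hP := Measure.isProbabilityMeasure_map hZ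
  unfold VaR
  simp only [← cdf_map_eq hZ]
  set F := ProbabilityTheory.cdf (P.map Z)
  have hne : {x : ℝ | u ≤ F x}.Nonempty :=
    (((ProbabilityTheory.tendsto_cdf_atTop (P.map Z)).eventually (lt_mem_nhds hu.2)).exists).imp
      fun _ h => h.le
  have hbdd : BddBelow {x : ℝ | u ≤ F x} := by
    obtain ⟨a, ha⟩ :=
      ((ProbabilityTheory.tendsto_cdf_atBot (P.map Z)).eventually (gt_mem_nhds hu.1)).exists
    refine ⟨a, fun x hx => ?_⟩
    by_contra! h
    exact absurd (hx.trans (F.mono h.le)) (not_le.2 ha)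
  refine ⟨fun h => ?_, fun h => csInf_le hbdd h⟩
  have hmem : u ≤ F (sInf {x : ℝ | u ≤ F x}) := by
    have hc := (F.right_continuous (sInf {x : ℝ | u ≤ F x})).mono_left
      (nhdsWithin_mono _ Ioi_subset_Ici_self)
    refine ge_of_tendsto hc ?_
    filter_upwards [self_mem_nhdsWithin] with x hx
    obtain ⟨a, ha, hax⟩ := exists_lt_of_csInf_lt hne hx
    exact le_trans ha (F.mono hax.le)
  exact hmem.trans (F.mono h)

lemma monotoneOn_VaR {Z : Ω → ℝ} (hZ : AEMeasurable Z P) :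
    MonotoneOn (fun u => VaR P u Z) (Ioo (0 : ℝ) 1) := fun _ hu _ hv huv =>
  (VaR_le_iff hZ hu).2 (huv.trans ((VaR_le_iff hZ hv).1 le_rfl))

lemma aemeasurable_VaR {Z : Ω → ℝ} (hZ : AEMeasurable Z P) :
    AEMeasurable (fun u => VaR P u Z) (volume.restrict (Ioo (0 : ℝ) 1)) :=
  aemeasurable_restrict_of_monotoneOn measurableSet_Ioo (monotoneOn_VaR hZ)

instance isProbabilityMeasure_volume_Ioo :
    IsProbabilityMeasure (volume.restrict (Ioo (0 : ℝ) 1)) :=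
  ⟨by simp⟩

/-- The quantile function, under the uniform distribution on `(0, 1)`, has the law of `Z`. -/
lemma map_VaR {Z : Ω → ℝ} (hZ : AEMeasurable Z P) :
    (volume.restrict (Ioo (0 : ℝ) 1)).map (fun u => VaR P u Z) = P.map Z := by
  have hP := Measure.isProbabilityMeasure_map hZ
  have hQ := Measure.isProbabilityMeasure_map (aemeasurable_VaR hZ)
  refine Measure.ext_of_Iic _ _ fun t => ?_
  rw [Measure.map_apply_of_aemeasurable (aemeasurable_VaR hZ) measurableSet_Iic,
    Measure.map_apply_of_aemeasurable hZ measurableSet_Iic, Measure.restrict_apply₀']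
  · have h1 : (fun u => VaR P u Z) ⁻¹' Iic t ∩ Ioo 0 1
        = Iic (P.real {ω | Z ω ≤ t}) ∩ Ioo 0 1 := by
      ext u
      simp only [mem_inter_iff, mem_preimage, mem_Iic, and_congr_left_iff]
      exact fun hu => VaR_le_iff hZ hu
    have h2 : volume (Iic (P.real {ω | Z ω ≤ t}) ∩ Ioo 0 1)
        = volume (Ioc 0 (P.real {ω | Z ω ≤ t})) := by
      have hle : P.real {ω | Z ω ≤ t} ≤ 1 := measureReal_le_one
      have h4 : Iic (P.real {ω | Z ω ≤ t}) ∩ Ioc 0 1 = Ioc 0 (P.real {ω | Z ω ≤ t}) := by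
        ext u
        simp only [mem_inter_iff, mem_Iic, mem_Ioc]
        exact ⟨fun h => ⟨h.2.1, h.1⟩, fun h => ⟨h.2, h.1, h.2.trans hle⟩⟩
      rw [← h4]
      exact measure_congr (ae_eq_set_inter (Filter.EventuallyEq.refl _ _) Ioo_ae_eq_Ioc)
    rw [h1, h2, Real.volume_Ioc, sub_zero, ofReal_measureReal]
    rfl
  · exact measurableSet_Ioo.nullMeasurableSet

lemma integral_comp_VaR {Z : Ω → ℝ} (hZ : AEMeasurable Z P) {g : ℝ → ℝ} (hg : Measurable g) :
    ∫ u in Ioo (0 : ℝ) 1, g (VaR P u Z) = ∫ ω, g (Z ω) ∂P := by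
  rw [← integral_map hZ hg.aestronglyMeasurable, ← map_VaR hZ,
    integral_map (aemeasurable_VaR hZ) hg.aestronglyMeasurable]

lemma integrable_comp_VaR_iff {Z : Ω → ℝ} (hZ : AEMeasurable Z P) {g : ℝ → ℝ}
    (hg : Measurable g) :
    IntegrableOn (fun u => g (VaR P u Z)) (Ioo (0 : ℝ) 1) ↔ Integrable (fun ω => g (Z ω)) P := by
  have h1 := integrable_map_measure (μ := P) (f := Z) (g := g) hg.aestronglyMeasurable hZ
  have h2 := integrable_map_measure (μ := volume.restrict (Ioo (0 : ℝ) 1))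
    (f := fun u => VaR P u Z) (g := g) hg.aestronglyMeasurable (aemeasurable_VaR hZ)
  rw [map_VaR hZ] at h2
  exact h2.symm.trans h1

end Quantile

/-! ### Average Value-at-Risk: tail bound and monotonicity -/

section AverageValueAtRisk

variable {Ω : Type*} [MeasurableSpace Ω] {P : Measure Ω}

lemma IsDensity.integrable_mul {Y Z : Ω → ℝ} (hZ : IsDensity P Z) (hY : Integrable Y P) {c : ℝ}
    (hc : ∀ᵐ ω ∂P, Z ω ≤ c) : Integrable (fun ω => Y ω * Z ω) P := by
  refine hY.mul_bdd (c := c) hZ.integrable.aestronglyMeasurable ?_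
  filter_upwards [hc, hZ.nonneg] with ω h1 h2
  rwa [Real.norm_of_nonneg h2]

variable [IsProbabilityMeasure P]

lemma isDensity_one : IsDensity P (fun _ => 1) :=
  ⟨integrable_const _, by simp, by simp⟩

/-- With c = VaR_x(Y), integrate the pointwise bound YZ ≤ cZ + (Y - c)⁺ / (1 - x); the mean of (Y -
c)⁺ is computed on the quantile side. -/
lemma IsDensity.integral_mul_le {Y Z : Ω → ℝ} (hZ : IsDensity P Z) (hY : Integrable Y P) {x : ℝ}
    (hx : x ∈ Ico (0 : ℝ) 1) (hc : ∀ᵐ ω ∂P, Z ω ≤ 1 / (1 - x)) :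
    ∫ ω, Y ω * Z ω ∂P ≤ 1 / (1 - x) * ∫ u in Ioo x 1, VaR P u Y := by
  have hYm := hY.aemeasurable
  have hQ : IntegrableOn (fun u => VaR P u Y) (Ioo (0 : ℝ) 1) :=
    (integrable_comp_VaR_iff hYm measurable_id).2 hY
  have hYZ := hZ.integrable_mul hY hc
  -- At x = 0 there is no quantile to split at, but Z ≤ 1 and E Z = 1 force Z = 1.
  rcases hx.1.eq_or_lt with rfl | hx0
  · have h1 : ∀ᵐ ω ∂P, Z ω = 1 := by
      have h2 : (fun ω => 1 - Z ω) =ᵐ[P] 0 := by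
        rw [← integral_eq_zero_iff_of_nonneg_ae]
        · rw [integral_sub (integrable_const _) hZ.integrable, hZ.integral_eq_one]; simp
        · filter_upwards [hc] with ω h
          simp only [Pi.zero_apply]
          norm_num at h
          linarith
        · exact (integrable_const _).sub hZ.integrable
      filter_upwards [h2] with ω h
      simp only [Pi.zero_apply] at h
      linarith
    have h3 : ∫ ω, Y ω * Z ω ∂P = ∫ ω, Y ω ∂P := by
      refine integral_congr_ae ?_
      filter_upwards [h1] with ω h
      rw [h, mul_one]
    have h4 := integral_comp_VaR hYm measurable_id
    simp only [id] at h4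
    rw [h3, h4]
    simp
  · have hxI : x ∈ Ioo (0 : ℝ) 1 := ⟨hx0, hx.2⟩
    have h1x : 0 < 1 - x := by linarith [hx.2]
    set c := VaR P x Y with hcdef
    have hpos : Integrable (fun ω => max (Y ω - c) 0) P := (hY.sub (integrable_const c)).pos_part
    have h1 : ∫ ω, Y ω * Z ω ∂P ≤ ∫ ω, (c * Z ω + 1 / (1 - x) * max (Y ω - c) 0) ∂P := by
      refine integral_mono_ae hYZ ((hZ.integrable.const_mul c).add (hpos.const_mul _)) ?_
      filter_upwards [hc, hZ.nonneg] with ω h1 h2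
      have h3 : (Y ω - c) * Z ω ≤ max (Y ω - c) 0 * (1 / (1 - x)) :=
        (mul_le_mul_of_nonneg_right (le_max_left _ _) h2).trans
          (mul_le_mul_of_nonneg_left h1 (le_max_right _ _))
      linarith
    rw [integral_add (hZ.integrable.const_mul c) (hpos.const_mul _), integral_const_mul,
      integral_const_mul, hZ.integral_eq_one, mul_one] at h1
    have hg : Measurable (fun y : ℝ => max (y - c) 0) := by fun_prop
    have h2 : ∫ ω, max (Y ω - c) 0 ∂P = ∫ u in Ioo x 1, (VaR P u Y - c) := by
      rw [← integral_comp_VaR hYm hg]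
      have hsub : Ioo x 1 ⊆ Ioo 0 1 := Ioo_subset_Ioo_left hx0.le
      rw [setIntegral_eq_of_subset_of_forall_sdiff_eq_zero measurableSet_Ioo hsub]
      · refine setIntegral_congr_fun measurableSet_Ioo fun u hu => ?_
        exact max_eq_left (sub_nonneg.2 (monotoneOn_VaR hYm hxI (hsub hu) hu.1.le))
      · rintro u ⟨hu, hux⟩
        have : u ≤ x := by
          by_contra! h
          exact hux ⟨h, hu.2⟩
        change max (VaR P u Y - c) 0 = 0
        exact max_eq_right (sub_nonpos.2 (monotoneOn_VaR hYm hu hxI this))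
    have h3 : ∫ u in Ioo x 1, (VaR P u Y - c) = (∫ u in Ioo x 1, VaR P u Y) - (1 - x) * c := by
      rw [integral_sub (hQ.mono_set (Ioo_subset_Ioo_left hx0.le)) (integrable_const _)]
      simp [Measure.real, hx.2.le]
    rw [h2, h3] at h1
    refine h1.trans (le_of_eq ?_)
    field_simp
    ring

lemma bddAbove_AVaR {Y : Ω → ℝ} (hY : Integrable Y P) {x : ℝ} (hx : x ∈ Ico (0 : ℝ) 1) :
    BddAbove {r | ∃ Z : Ω → ℝ, IsDensity P Z ∧ (∀ᵐ ω ∂P, Z ω ≤ 1 / (1 - x)) ∧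
      r = ∫ ω, Y ω * Z ω ∂P} := by
  refine ⟨1 / (1 - x) * ∫ u in Ioo x 1, VaR P u Y, ?_⟩
  rintro r ⟨Z, hZ, hc, rfl⟩
  exact hZ.integral_mul_le hY hx hc

lemma le_AVaR {Y Z : Ω → ℝ} (hY : Integrable Y P) {x : ℝ} (hx : x ∈ Ico (0 : ℝ) 1)
    (hZ : IsDensity P Z) (hc : ∀ᵐ ω ∂P, Z ω ≤ 1 / (1 - x)) :
    ∫ ω, Y ω * Z ω ∂P ≤ AVaR P x Y :=
  le_csSup (bddAbove_AVaR hY hx) ⟨Z, hZ, hc, rfl⟩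

lemma one_le_one_div_one_sub {x : ℝ} (hx : x ∈ Ico (0 : ℝ) 1) : 1 ≤ 1 / (1 - x) := by
  rw [le_div_iff₀ (by linarith [hx.2])]
  linarith [hx.1]

lemma integral_le_AVaR {Y : Ω → ℝ} (hY : Integrable Y P) {x : ℝ} (hx : x ∈ Ico (0 : ℝ) 1) :
    ∫ ω, Y ω ∂P ≤ AVaR P x Y := by
  have := le_AVaR hY hx (isDensity_one (P := P))
    (Filter.Eventually.of_forall fun _ => one_le_one_div_one_sub hx)
  simpa using this

lemma AVaR_le {Y : Ω → ℝ} (hY : Integrable Y P) {x : ℝ} (hx : x ∈ Ico (0 : ℝ) 1) :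
    AVaR P x Y ≤ 1 / (1 - x) * ∫ u in Ioo x 1, VaR P u Y := by
  refine csSup_le ⟨_, fun _ => 1, isDensity_one,
    Filter.Eventually.of_forall fun _ => one_le_one_div_one_sub hx, rfl⟩ ?_
  rintro r ⟨Z, hZ, hc, rfl⟩
  exact hZ.integral_mul_le hY hx hc

lemma monotoneOn_AVaR {Y : Ω → ℝ} (hY : Integrable Y P) :
    MonotoneOn (fun x => AVaR P x Y) (Ico (0 : ℝ) 1) := by
  intro x hx x' hx' hxx'
  refine csSup_le ⟨_, fun _ => 1, isDensity_one,
    Filter.Eventually.of_forall fun _ => one_le_one_div_one_sub hx, rfl⟩ ?_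
  rintro r ⟨Z, hZ, hc, rfl⟩
  refine le_AVaR hY hx' hZ (hc.mono fun ω h => h.trans ?_)
  exact one_div_le_one_div_of_le (by linarith [hx'.2]) (by linarith)

end AverageValueAtRisk

/-! ### Distortion functions and Fubini for their kernel -/

section Distortion

variable {μ : Measure ℝ}

lemma IsProbOnIco.ae_mem (hμ : IsProbOnIco μ) : ∀ᵐ v ∂μ, v ∈ Ico (0 : ℝ) 1 :=
  hμ.compl_null

/-- The kernel `1_{v ≤ u} (1 - v)⁻¹` whose `μ`-integral is the distortion function. -/
noncomputable def distortionKernel (v u : ℝ) : ℝ :=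
  if v ≤ u then 1 / (1 - v) else 0

lemma measurable_distortionKernel :
    Measurable (Function.uncurry distortionKernel) := by
  unfold distortionKernel Function.uncurry
  exact Measurable.ite (measurableSet_le measurable_fst measurable_snd) (by fun_prop)
    measurable_const

lemma distortionKernel_nonneg {v u : ℝ} (hv : v ∈ Ico (0 : ℝ) 1) : 0 ≤ distortionKernel v u := by
  unfold distortionKernel
  split_ifs
  · exact div_nonneg zero_le_one (by linarith [hv.2])
  · exact le_rfl

lemma IsProbOnIco.integral_distortionKernel (hμ : IsProbOnIco μ) (u : ℝ) :
    ∫ v, distortionKernel v u ∂μ = distortion μ u := by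
  unfold distortion
  rw [← integral_indicator measurableSet_Icc]
  refine integral_congr_ae ?_
  filter_upwards [hμ.ae_mem] with v hv
  by_cases h : v ≤ u
  · rw [indicator_of_mem (show v ∈ Icc 0 u from ⟨hv.1, h⟩)]
    simp [distortionKernel, h]
  · rw [indicator_of_notMem (fun h' : v ∈ Icc 0 u => h h'.2)]
    simp [distortionKernel, h]

lemma IsProbOnIco.integrable_distortionKernel (hμ : IsProbOnIco μ) {u : ℝ} (hu : u < 1) :
    Integrable (fun v => distortionKernel v u) μ := by
  have := hμ.isProbabilityMeasure
  refine Integrable.of_bound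
    (measurable_distortionKernel.comp measurable_prodMk_right).aestronglyMeasurable
    (1 / (1 - u)) ?_
  filter_upwards [hμ.ae_mem] with v hv
  rw [Real.norm_of_nonneg (distortionKernel_nonneg hv)]
  unfold distortionKernel
  split_ifs with h
  · exact one_div_le_one_div_of_le (by linarith) (by linarith)
  · exact div_nonneg zero_le_one (by linarith)

lemma integral_mul_distortionKernel (f : ℝ → ℝ) {v : ℝ} (hv : v ∈ Ico (0 : ℝ) 1) :
    ∫ u in Ioo (0 : ℝ) 1, f u * distortionKernel v u = 1 / (1 - v) * ∫ u in Ioo v 1, f u := by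
  have h1 : ∀ u, f u * distortionKernel v u
      = (Ici v).indicator (fun u => 1 / (1 - v) * f u) u := by
    intro u
    by_cases h : v ≤ u
    · rw [indicator_of_mem (show u ∈ Ici v from h)]
      simp [distortionKernel, h, mul_comm]
    · rw [indicator_of_notMem (show u ∉ Ici v from h)]
      simp [distortionKernel, h]
  simp_rw [h1]
  rw [setIntegral_indicator measurableSet_Ici, integral_const_mul]
  congr 1
  refine setIntegral_congr_set ?_
  have h2 : (Ioo (0 : ℝ) 1 ∩ Ioi v : Set ℝ) = Ioo v 1 := by
    ext u
    simp only [mem_inter_iff, mem_Ioo, mem_Ioi]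
    exact ⟨fun h => ⟨h.2, h.1.2⟩, fun h => ⟨⟨hv.1.trans_lt h.1, h.2⟩, h.1⟩⟩
  rw [← h2]
  exact ae_eq_set_inter (Filter.EventuallyEq.refl _ _) Ioi_ae_eq_Ici.symm

lemma IsProbOnIco.distortion_nonneg (hμ : IsProbOnIco μ) (u : ℝ) : 0 ≤ distortion μ u := by
  rw [← hμ.integral_distortionKernel]
  exact integral_nonneg_of_ae (hμ.ae_mem.mono fun v hv => distortionKernel_nonneg hv)

/-- For each v in [0, 1) the kernel has u-integral one, and μ is finite. -/
lemma IsProbOnIco.integrable_prod_distortionKernel (hμ : IsProbOnIco μ) :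
    Integrable (Function.uncurry distortionKernel)
      (μ.prod (volume.restrict (Ioo (0 : ℝ) 1))) := by
  have := hμ.isProbabilityMeasure
  rw [integrable_prod_iff measurable_distortionKernel.aestronglyMeasurable]
  constructor
  · filter_upwards [hμ.ae_mem] with v hv
    refine Integrable.of_bound
      (measurable_distortionKernel.comp measurable_prodMk_left).aestronglyMeasurable
      (1 / (1 - v)) (Filter.Eventually.of_forall fun u => ?_)
    simp only [Function.uncurry]
    rw [Real.norm_of_nonneg (distortionKernel_nonneg hv)]
    unfold distortionKernel
    split_ifs
    · exact le_rfl
    · exact div_nonneg zero_le_one (by linarith [hv.2])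
  · refine (integrable_const (1 : ℝ)).congr ?_
    filter_upwards [hμ.ae_mem] with v hv
    have h := integral_mul_distortionKernel (fun _ => 1) hv
    simp only [one_mul] at h
    have h1 : (0 : ℝ) < 1 - v := by linarith [hv.2]
    simp only [Function.uncurry, Real.norm_of_nonneg (distortionKernel_nonneg hv), h]
    simp [Measure.real, hv.2.le, h1.ne']

lemma IsProbOnIco.integrableOn_distortion (hμ : IsProbOnIco μ) :
    IntegrableOn (distortion μ) (Ioo (0 : ℝ) 1) := by
  have := hμ.isProbabilityMeasure
  have h := hμ.integrable_prod_distortionKernel.integral_prod_right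
  simp only [Function.uncurry, hμ.integral_distortionKernel] at h
  exact h

lemma IsProbOnIco.integrable_prod_mul_distortionKernel (hμ : IsProbOnIco μ) {f : ℝ → ℝ}
    (hf : AEStronglyMeasurable f (volume.restrict (Ioo (0 : ℝ) 1)))
    (hfσ : IntegrableOn (fun u => f u * distortion μ u) (Ioo (0 : ℝ) 1)) :
    Integrable (fun z : ℝ × ℝ => f z.2 * distortionKernel z.1 z.2)
      (μ.prod (volume.restrict (Ioo (0 : ℝ) 1))) := by
  have := hμ.isProbabilityMeasure
  have hm : AEStronglyMeasurable (fun z : ℝ × ℝ => f z.2 * distortionKernel z.1 z.2)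
      (μ.prod (volume.restrict (Ioo (0 : ℝ) 1))) :=
    hf.comp_snd.mul measurable_distortionKernel.aestronglyMeasurable
  rw [integrable_prod_iff' hm]
  constructor
  · filter_upwards [ae_restrict_mem measurableSet_Ioo] with u hu
    exact (hμ.integrable_distortionKernel hu.2).const_mul (f u)
  · refine hfσ.norm.congr (Filter.Eventually.of_forall fun u => ?_)
    simp only [norm_mul, Real.norm_of_nonneg (hμ.distortion_nonneg u)]
    rw [integral_const_mul, ← hμ.integral_distortionKernel]
    congr 1
    refine integral_congr_ae (hμ.ae_mem.mono fun v hv => ?_)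
    exact (Real.norm_of_nonneg (distortionKernel_nonneg hv)).symm

lemma IsProbOnIco.integrable_tail_average (hμ : IsProbOnIco μ) {f : ℝ → ℝ}
    (hf : AEStronglyMeasurable f (volume.restrict (Ioo (0 : ℝ) 1)))
    (hfσ : IntegrableOn (fun u => f u * distortion μ u) (Ioo (0 : ℝ) 1)) :
    Integrable (fun v => 1 / (1 - v) * ∫ u in Ioo v 1, f u) μ := by
  refine (hμ.integrable_prod_mul_distortionKernel hf hfσ).integral_prod_left.congr ?_
  exact hμ.ae_mem.mono fun v hv => integral_mul_distortionKernel f hv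

/-- Fubini for the kernel. Used with f = 1 (the distortion has mass one), with f the quantile
function of Y (the upper bound in the representation) and with f an indicator (integration by
parts). -/
lemma IsProbOnIco.integral_tail_average (hμ : IsProbOnIco μ) {f : ℝ → ℝ}
    (hf : AEStronglyMeasurable f (volume.restrict (Ioo (0 : ℝ) 1)))
    (hfσ : IntegrableOn (fun u => f u * distortion μ u) (Ioo (0 : ℝ) 1)) :
    ∫ v, (1 / (1 - v) * ∫ u in Ioo v 1, f u) ∂μ = ∫ u in Ioo (0 : ℝ) 1, f u * distortion μ u := by
  have := hμ.isProbabilityMeasure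
  have h1 : ∫ v, (1 / (1 - v) * ∫ u in Ioo v 1, f u) ∂μ
      = ∫ v, (∫ u in Ioo (0 : ℝ) 1, f u * distortionKernel v u) ∂μ :=
    integral_congr_ae (hμ.ae_mem.mono fun v hv => (integral_mul_distortionKernel f hv).symm)
  rw [h1, integral_integral_swap (hμ.integrable_prod_mul_distortionKernel hf hfσ)]
  simp_rw [integral_const_mul, hμ.integral_distortionKernel]

lemma IsProbOnIco.integral_distortion (hμ : IsProbOnIco μ) :
    ∫ u in Ioo (0 : ℝ) 1, distortion μ u = 1 := by
  have := hμ.isProbabilityMeasure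
  have h := hμ.integral_tail_average (f := fun _ => 1) aestronglyMeasurable_const
    (by simpa using hμ.integrableOn_distortion)
  simp only [one_mul] at h
  rw [← h]
  have h1 : ∀ᵐ v ∂μ, 1 / (1 - v) * ∫ _ in Ioo v 1, (1 : ℝ) = 1 := by
    filter_upwards [hμ.ae_mem] with v hv
    have h1 : (0 : ℝ) < 1 - v := by linarith [hv.2]
    simp [Measure.real, hv.2.le, h1.ne']
  rw [integral_congr_ae h1]
  simp

end Distortion

/-! ### Integrating the Average Value-at-Risk over its level -/

section AverageValueAtRisk

variable {Ω : Type*} [MeasurableSpace Ω] {P : Measure Ω} [IsProbabilityMeasure P] {μ : Measure ℝ}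

/-- Monotonicity in the level gives measurability; the function lies between the constant E Y and
the integrable tail average. -/
lemma IsProbOnIco.integrable_AVaR (hμ : IsProbOnIco μ) {Y : Ω → ℝ} (hY : Integrable Y P)
    (h : IntegrableOn (fun u => VaR P u Y * distortion μ u) (Ioo (0 : ℝ) 1)) :
    Integrable (fun x => AVaR P x Y) μ := by
  have := hμ.isProbabilityMeasure
  have hm : AEStronglyMeasurable (fun x => AVaR P x Y) μ := by
    have h1 := aemeasurable_restrict_of_monotoneOn (μ := μ) measurableSet_Ico
      (monotoneOn_AVaR (P := P) hY)
    rw [Measure.restrict_eq_self_of_ae_mem hμ.ae_mem] at h1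
    exact h1.aestronglyMeasurable
  have hu := hμ.integrable_tail_average (aemeasurable_VaR hY.aemeasurable).aestronglyMeasurable h
  refine integrable_of_le_of_le hm ?_ ?_ (integrable_const (∫ ω, Y ω ∂P)) hu
  · exact hμ.ae_mem.mono fun x hx => integral_le_AVaR hY hx
  · exact hμ.ae_mem.mono fun x hx => AVaR_le hY hx

lemma IsProbOnIco.integral_AVaR_le (hμ : IsProbOnIco μ) {Y : Ω → ℝ} (hY : Integrable Y P)
    (h : IntegrableOn (fun u => VaR P u Y * distortion μ u) (Ioo (0 : ℝ) 1)) :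
    ∫ x, AVaR P x Y ∂μ ≤ ∫ u in Ioo (0 : ℝ) 1, VaR P u Y * distortion μ u := by
  have hm := (aemeasurable_VaR hY.aemeasurable).aestronglyMeasurable
  rw [← hμ.integral_tail_average hm h]
  exact integral_mono_ae (hμ.integrable_AVaR hY h) (hμ.integrable_tail_average hm h)
    (hμ.ae_mem.mono fun x hx => AVaR_le hY hx)

end AverageValueAtRisk

/-! ### Conjugate exponents and the entropy constraint -/

section Exponents

lemma one_lt_conjExponent {p : ℝ} (hp : 1 < p) : 1 < p.conjExponent := by
  unfold Real.conjExponent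
  rw [lt_div_iff₀ (by linarith)]
  linarith

lemma conjExponent_pos_of_neg {p : ℝ} (hp : p < 0) : 0 < p.conjExponent :=
  div_pos_of_neg_of_neg hp (by linarith)

lemma conjExponent_lt_one_of_neg {p : ℝ} (hp : p < 0) : p.conjExponent < 1 := by
  unfold Real.conjExponent
  rw [div_lt_iff_of_neg (by linarith)]
  linarith

lemma conjExponent_pos {p : ℝ} (hp : 1 < p ∨ p < 0) : 0 < p.conjExponent :=
  hp.elim (fun h => zero_lt_one.trans (one_lt_conjExponent h)) conjExponent_pos_of_neg

/-- The entropy constraint as a bound on the `p'`-th moment. -/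
lemma entropy_le_iff {p α I : ℝ} (hα : α < 1) (hp : 1 < p ∨ p < 0) (hI : 0 < I) :
    1 / (p.conjExponent - 1) * Real.log I ≤ Real.log (1 / (1 - α)) ↔
      (1 < p → I ≤ (1 / (1 - α)) ^ (p.conjExponent - 1)) ∧
      (p < 0 → (1 / (1 - α)) ^ (p.conjExponent - 1) ≤ I) := by
  have hR : (0 : ℝ) < 1 / (1 - α) := one_div_pos.2 (by linarith)
  have hRq : 0 < (1 / (1 - α)) ^ (p.conjExponent - 1) := Real.rpow_pos_of_pos hR _
  rw [one_div_mul_eq_div]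
  rcases hp with hp | hp
  · have hq := one_lt_conjExponent hp
    rw [div_le_iff₀ (by linarith), mul_comm, ← Real.log_rpow hR, Real.log_le_log_iff hI hRq]
    exact ⟨fun h => ⟨fun _ => h, fun h' => absurd h' (by linarith)⟩, fun h => h.1 hp⟩
  · have hq := conjExponent_lt_one_of_neg hp
    rw [div_le_iff_of_neg (by linarith), mul_comm, ← Real.log_rpow hR, Real.log_le_log_iff hRq hI]
    exact ⟨fun h => ⟨fun h' => absurd h' (by linarith), fun _ => h⟩, fun h => h.2 hp⟩

end Exponents

/-! ### Pairing with densities and finiteness of the supremum -/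

section Duality

variable {Ω : Type*} [MeasurableSpace Ω] {P : Measure Ω} {p : ℝ} {Y Z : Ω → ℝ}

/-- `Y` is in `L^p` if `p > 1` and in `L^∞` if `p < 0`. -/
def HasMoment (P : Measure Ω) (p : ℝ) (Y : Ω → ℝ) : Prop :=
  (1 < p ∧ MemLp Y (ENNReal.ofReal p) P) ∨ (p < 0 ∧ MemLp Y ⊤ P)

lemma HasMoment.order (hY : HasMoment P p Y) : 1 < p ∨ p < 0 :=
  hY.imp And.left And.left

lemma HasMoment.aestronglyMeasurable (hY : HasMoment P p Y) : AEStronglyMeasurable Y P :=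
  hY.elim (fun h => h.2.1) fun h => h.2.1

lemma HasMoment.integrable [IsFiniteMeasure P] (hY : HasMoment P p Y) : Integrable Y P := by
  rcases hY with ⟨hp, hY⟩ | ⟨-, hY⟩
  · exact hY.integrable (by simpa using hp.le)
  · exact hY.integrable le_top

lemma integrable_abs_rpow {p : ℝ} (hp : 0 < p) (hY : MemLp Y (ENNReal.ofReal p) P) :
    Integrable (fun ω => |Y ω| ^ p) P := by
  have := hY.integrable_norm_rpow (by simpa using hp) ENNReal.ofReal_ne_top
  simpa only [ENNReal.toReal_ofReal hp.le, Real.norm_eq_abs] using this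

lemma abs_mul_le_young (hp : 1 < p) (y : ℝ) {z : ℝ} (hz : 0 ≤ z) :
    |y * z| ≤ |y| ^ p / p + z ^ p.conjExponent / p.conjExponent := by
  have := Real.young_inequality |y| z (Real.HolderConjugate.conjExponent hp)
  rwa [abs_abs, abs_of_nonneg hz, ← abs_of_nonneg hz, ← abs_mul, abs_of_nonneg hz] at this

lemma exists_ae_norm_le (hY : MemLp Y ⊤ P) : ∃ C, ∀ᵐ ω ∂P, ‖Y ω‖ ≤ C := by
  refine ⟨(eLpNorm Y ⊤ P).toReal, ?_⟩
  filter_upwards [ae_le_eLpNormEssSup (f := Y) (μ := P)] with ω h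
  rw [← eLpNorm_exponent_top] at h
  have := ENNReal.toReal_mono hY.2.ne h
  simpa using this

lemma HasMoment.integrable_mul (hY : HasMoment P p Y) (hZ : Integrable Z P)
    (hZ0 : ∀ᵐ ω ∂P, 0 ≤ Z ω) (hZq : Integrable (fun ω => Z ω ^ p.conjExponent) P) :
    Integrable (fun ω => Y ω * Z ω) P := by
  have hYm := hY.aestronglyMeasurable
  rcases hY with ⟨hp, hY⟩ | ⟨-, hY⟩
  · refine (((integrable_abs_rpow (by linarith) hY).div_const p).add
      (hZq.div_const p.conjExponent)).mono' (hYm.mul hZ.1) ?_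
    filter_upwards [hZ0] with ω h
    exact abs_mul_le_young hp _ h
  · obtain ⟨C, hC⟩ := exists_ae_norm_le hY
    exact hZ.bdd_mul hYm hC

/-- A density cannot vanish almost everywhere. Positivity is needed to undo the logarithm in the
entropy, since `Real.log 0 = 0`. -/
lemma IsDensity.integral_rpow_pos (hZ : IsDensity P Z) {q : ℝ} (hq : 0 < q)
    (hZq : Integrable (fun ω => Z ω ^ q) P) : 0 < ∫ ω, Z ω ^ q ∂P := by
  have h0 : 0 ≤ᵐ[P] fun ω => Z ω ^ q := hZ.nonneg.mono fun ω h => Real.rpow_nonneg h q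
  refine lt_of_le_of_ne (integral_nonneg_of_ae h0) fun h => ?_
  have h1 := (integral_eq_zero_iff_of_nonneg_ae h0 hZq).1 h.symm
  have h2 : Z =ᵐ[P] fun _ => 0 := by
    filter_upwards [h1, hZ.nonneg] with ω h h'
    exact (Real.rpow_eq_zero h' hq.ne').1 h
  have h3 := hZ.integral_eq_one
  rw [integral_congr_ae h2] at h3
  simp at h3

lemma IsDensity.isFeasibleDensity_iff (hZ : IsDensity P Z) {α : ℝ} (hα : α < 1)
    (hp : 1 < p ∨ p < 0) (hZq : Integrable (fun ω => Z ω ^ p.conjExponent) P) :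
    IsFeasibleDensity P p α Z ↔
      (1 < p → ∫ ω, Z ω ^ p.conjExponent ∂P ≤ (1 / (1 - α)) ^ (p.conjExponent - 1)) ∧
      (p < 0 → (1 / (1 - α)) ^ (p.conjExponent - 1) ≤ ∫ ω, Z ω ^ p.conjExponent ∂P) := by
  rw [← entropy_le_iff hα hp (hZ.integral_rpow_pos (conjExponent_pos hp) hZq)]
  exact ⟨fun h => h.entropy_le, fun h => ⟨hZ, hZq, h⟩⟩

/-- For p > 1, Young's inequality separates Y from Z and the constraint bounds the moment of Z; for
p < 0, an essential bound on Y suffices. -/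
lemma bddAbove_evarValues {α : ℝ} (hα : α < 1) (hY : HasMoment P p Y) :
    BddAbove (evarValues P p α Y) := by
  have hY' := hY
  rcases hY with ⟨hp, hYp⟩ | ⟨-, hYp⟩
  · refine ⟨(∫ ω, |Y ω| ^ p ∂P) / p + (1 / (1 - α)) ^ (p.conjExponent - 1) / p.conjExponent, ?_⟩
    rintro r ⟨Z, hZ, rfl⟩
    have hD := hZ.isDensity
    have h1 := ((hD.isFeasibleDensity_iff hα (Or.inl hp) hZ.integrable_rpow).1 hZ).1 hp
    have hi := integrable_abs_rpow (by linarith) hYp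
    have h2 : ∫ ω, Y ω * Z ω ∂P
        ≤ ∫ ω, (|Y ω| ^ p / p + Z ω ^ p.conjExponent / p.conjExponent) ∂P := by
      refine integral_mono_ae (hY'.integrable_mul hD.integrable hD.nonneg hZ.integrable_rpow)
        ((hi.div_const p).add (hZ.integrable_rpow.div_const _)) ?_
      filter_upwards [hD.nonneg] with ω h
      exact (le_abs_self _).trans (abs_mul_le_young hp _ h)
    rw [integral_add (hi.div_const p) (hZ.integrable_rpow.div_const _), integral_div,
      integral_div] at h2
    have hq : 0 < p.conjExponent := conjExponent_pos (Or.inl hp)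
    refine h2.trans ?_
    gcongr
  · obtain ⟨C, hC⟩ := exists_ae_norm_le hYp
    refine ⟨C, ?_⟩
    rintro r ⟨Z, hZ, rfl⟩
    have hD := hZ.isDensity
    have h2 : ∫ ω, Y ω * Z ω ∂P ≤ ∫ ω, C * Z ω ∂P := by
      refine integral_mono_ae (hY'.integrable_mul hD.integrable hD.nonneg hZ.integrable_rpow)
        (hD.integrable.const_mul C) ?_
      filter_upwards [hD.nonneg, hC] with ω h h'
      exact mul_le_mul_of_nonneg_right ((le_abs_self _).trans h') h
    rwa [integral_const_mul, hD.integral_eq_one, mul_one] at h2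

variable [IsProbabilityMeasure P]

lemma HasMoment.VaR (hY : HasMoment P p Y) :
    HasMoment (volume.restrict (Ioo (0 : ℝ) 1)) p (fun u => VaR P u Y) := by
  have hYm := hY.aestronglyMeasurable.aemeasurable
  have key : ∀ r, MemLp Y r P → MemLp (fun u => EntropicRisk.VaR P u Y) r
      (volume.restrict (Ioo (0 : ℝ) 1)) := by
    intro r hr
    have h1 := memLp_map_measure_iff (p := r) (g := id) aestronglyMeasurable_id hYm
    have h2 := memLp_map_measure_iff (p := r) (g := id) aestronglyMeasurable_id
      (aemeasurable_VaR hYm)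
    rw [map_VaR hYm] at h2
    exact h2.1 (h1.2 hr)
  exact hY.imp (And.imp_right (key _)) (And.imp_right (key _))

lemma isFeasibleDensity_one (p : ℝ) {α : ℝ} (hα : α ∈ Ico (0 : ℝ) 1) :
    IsFeasibleDensity P p α (fun _ => 1) where
  isDensity := isDensity_one
  integrable_rpow := by simp
  entropy_le := by
    simpa [renyiEntropy] using Real.log_nonneg (one_le_one_div_one_sub hα)

lemma isLUB_EVaR {α : ℝ} (hα : α ∈ Ico (0 : ℝ) 1) (hY : HasMoment P p Y) :
    IsLUB (evarValues P p α Y) (EVaR P p α Y) :=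
  isLUB_csSup ⟨_, _, isFeasibleDensity_one p hα, rfl⟩ (bddAbove_evarValues hα.2 hY)

end Duality

/-! ### From admissible measures to feasible densities -/

section Transfer

variable {Ω : Type*} [MeasurableSpace Ω] {P : Measure Ω} [IsProbabilityMeasure P]

/-- Conditioning a density `σ` on `(0, 1)` on the quantile function of `Y` yields a density on `Ω`
with the same pairing with `Y` and with a smaller entropy. -/
lemma exists_density_of_density_Ioo {Y : Ω → ℝ} (hY : AEMeasurable Y P) {q : ℝ} (hq : 0 < q)
    {σ : ℝ → ℝ} (hσ : IsDensity (volume.restrict (Ioo (0 : ℝ) 1)) σ)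
    (hσq : IntegrableOn (fun u => σ u ^ q) (Ioo (0 : ℝ) 1))
    (hYσ : IntegrableOn (fun u => VaR P u Y * σ u) (Ioo (0 : ℝ) 1)) :
    ∃ Z : Ω → ℝ, IsDensity P Z ∧ Integrable (fun ω => Z ω ^ q) P ∧
      ∫ ω, Y ω * Z ω ∂P = ∫ u in Ioo (0 : ℝ) 1, VaR P u Y * σ u ∧
      (1 ≤ q → ∫ ω, Z ω ^ q ∂P ≤ ∫ u in Ioo (0 : ℝ) 1, σ u ^ q) ∧
      (q ≤ 1 → ∫ u in Ioo (0 : ℝ) 1, σ u ^ q ≤ ∫ ω, Z ω ^ q ∂P) := by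
  set lam : Measure ℝ := volume.restrict (Ioo (0 : ℝ) 1) with hlam
  have hQm := aemeasurable_VaR hY
  -- A measurable version is needed for the σ-algebra generated by the quantile function to be a
  -- sub-σ-algebra.
  set Q := hQm.mk _ with hQ
  have hQe : (fun u => VaR P u Y) =ᵐ[lam] Q := hQm.ae_eq_mk
  have hQmeas : Measurable Q := hQm.measurable_mk
  have hmap : lam.map Q = P.map Y := by rw [← Measure.map_congr hQe, map_VaR hY]
  have hm' : MeasurableSpace.comap Q inferInstance ≤ Real.measurableSpace := hQmeas.comap_le
  set g := lam[σ|MeasurableSpace.comap Q inferInstance] with hg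
  set gq := lam[fun u => σ u ^ q|MeasurableSpace.comap Q inferInstance] with hgq_def
  -- The conditional expectation factors through Q as h(Q). Since Q and Y have the same law, Z =
  -- h(Y) is the density sought.
  obtain ⟨h, hhm, hh⟩ :=
    (stronglyMeasurable_condExp (f := σ) (m := MeasurableSpace.comap Q inferInstance)
      (μ := lam)).exists_eq_measurable_comp
  have hh' : ∀ u, g u = h (Q u) := fun u => congrFun hh u
  have hint : ∀ k : ℝ → ℝ, Measurable k → ∫ ω, k (Y ω) ∂P = ∫ u, k (Q u) ∂lam := by
    intro k hk
    rw [← integral_map hY hk.aestronglyMeasurable, ← hmap,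
      integral_map hQmeas.aemeasurable hk.aestronglyMeasurable]
  have hinteg : ∀ k : ℝ → ℝ, Measurable k →
      (Integrable (fun ω => k (Y ω)) P ↔ Integrable (fun u => k (Q u)) lam) := by
    intro k hk
    have h1 := integrable_map_measure (μ := P) (f := Y) (g := k) hk.aestronglyMeasurable hY
    have h2 := integrable_map_measure (μ := lam) (f := Q) (g := k) hk.aestronglyMeasurable
      hQmeas.aemeasurable
    rw [hmap] at h2
    exact h1.symm.trans h2
  have hhmeas : Measurable h := hhm.measurable
  have hhq : Measurable fun y => h y ^ q := hhmeas.pow_const q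
  have hg0 : ∀ᵐ u ∂lam, 0 ≤ g u := condExp_nonneg hσ.nonneg
  have hgi : Integrable g lam := integrable_condExp
  have hYg : lam[Q * σ|MeasurableSpace.comap Q inferInstance] =ᵐ[lam] Q * g := by
    refine condExp_mul_of_stronglyMeasurable_left (comap_measurable Q).stronglyMeasurable ?_
      hσ.integrable
    exact hYσ.congr (hQe.mono fun u hu => by simp [hu])
  have hgm : AEStronglyMeasurable (fun u => g u ^ q) lam :=
    (hgi.1.aemeasurable.pow_const q).aestronglyMeasurable
  have hgq0 : ∀ᵐ u ∂lam, 0 ≤ g u ^ q := hg0.mono fun u hu => Real.rpow_nonneg hu q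
  have hcont : Continuous fun x : ℝ => x ^ q := Real.continuous_rpow_const hq.le
  -- Conditional Jensen: x ^ q is convex for q ≥ 1 and concave for q ≤ 1.
  have hJ1 : 1 ≤ q → (fun u => g u ^ q) ≤ᵐ[lam] gq := fun h1 =>
    (convexOn_rpow h1).map_condExp_le hm' hcont.continuousOn.lowerSemicontinuousOn
      hσ.nonneg isClosed_Ici hσ.integrable hσq
  have hJ2 : q ≤ 1 → gq ≤ᵐ[lam] fun u => g u ^ q := fun h1 =>
    (Real.concaveOn_rpow hq.le h1).condExp_map_le hm' hcont.continuousOn.upperSemicontinuousOn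
      hσ.nonneg isClosed_Ici hσ.integrable hσq
  have hgq : Integrable (fun u => g u ^ q) lam := by
    rcases le_total 1 q with h1 | h1
    · refine integrable_condExp.mono' (g := gq) hgm ?_
      filter_upwards [hJ1 h1, hgq0] with u hu hu0
      rwa [Real.norm_of_nonneg hu0]
    -- For q ≤ 1 the dominating function comes from x ^ q ≤ x + 1.
    · refine (hgi.add (integrable_const 1)).mono' hgm ?_
      filter_upwards [hg0, hgq0] with u hu hu0
      rw [Real.norm_of_nonneg hu0]
      simp only [Pi.add_apply]
      rcases le_total (g u) 1 with h2 | h2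
      · linarith [Real.rpow_le_one hu h2 hq.le]
      · have := Real.rpow_le_rpow_of_exponent_le h2 h1
        rw [Real.rpow_one] at this
        linarith
  have hZq : ∫ ω, h (Y ω) ^ q ∂P = ∫ u, g u ^ q ∂lam := by
    rw [hint _ hhq]
    simp only [hh']
  refine ⟨fun ω => h (Y ω), ⟨?_, ?_, ?_⟩, ?_, ?_, ?_, ?_⟩
  · rw [hinteg h hhmeas]
    exact hgi.congr (Filter.Eventually.of_forall hh')
  · have h1 : ∀ᵐ y ∂(lam.map Q), 0 ≤ h y := by
      rw [ae_map_iff hQmeas.aemeasurable (measurableSet_le measurable_const hhmeas)]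
      exact hg0.mono fun u hu => by rwa [← hh']
    rw [hmap] at h1
    exact ae_of_ae_map hY h1
  · rw [hint h hhmeas]
    simp only [← hh']
    rw [integral_condExp hm', hσ.integral_eq_one]
  · rw [hinteg _ hhq]
    simpa only [← hh'] using hgq
  · rw [hint (fun y => y * h y) (measurable_id.mul hhmeas)]
    simp only [← hh']
    rw [integral_congr_ae (g := lam[Q * σ|MeasurableSpace.comap Q inferInstance])
        (hYg.mono fun u hu => by simp [hu]),
      integral_condExp hm']
    exact integral_congr_ae (hQe.mono fun u hu => by simp [hu])
  · intro h1
    rw [hZq, ← integral_condExp hm' (f := fun u => σ u ^ q)]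
    exact integral_mono_ae hgq integrable_condExp (hJ1 h1)
  · intro h1
    rw [hZq, ← integral_condExp hm' (f := fun u => σ u ^ q)]
    exact integral_mono_ae integrable_condExp hgq (hJ2 h1)

lemma IsProbOnIco.isDensity_distortion {μ : Measure ℝ} (hμ : IsProbOnIco μ) :
    IsDensity (volume.restrict (Ioo (0 : ℝ) 1)) (distortion μ) :=
  ⟨hμ.integrableOn_distortion, Filter.Eventually.of_forall hμ.distortion_nonneg,
    hμ.integral_distortion⟩

variable {p α : ℝ} {Y : Ω → ℝ} {μ : Measure ℝ}

lemma IsAdmissible.integrable_VaR_mul (hμ : IsAdmissible p α μ) (hY : HasMoment P p Y) :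
    IntegrableOn (fun u => VaR P u Y * distortion μ u) (Ioo (0 : ℝ) 1) :=
  hY.VaR.integrable_mul hμ.isProbOnIco.integrableOn_distortion
    hμ.isProbOnIco.isDensity_distortion.nonneg hμ.integrableOn

lemma IsAdmissible.integrable_AVaR (hμ : IsAdmissible p α μ) (hY : HasMoment P p Y) :
    Integrable (fun x => AVaR P x Y) μ :=
  hμ.isProbOnIco.integrable_AVaR hY.integrable (hμ.integrable_VaR_mul hY)

lemma IsAdmissible.integral_AVaR_le_EVaR (hμ : IsAdmissible p α μ) (hα : α ∈ Ico (0 : ℝ) 1)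
    (hY : HasMoment P p Y) : ∫ x, AVaR P x Y ∂μ ≤ EVaR P p α Y := by
  have hYσ := hμ.integrable_VaR_mul hY
  have hq := conjExponent_pos hY.order
  obtain ⟨Z, hZ, hZq, hYZ, h1, h2⟩ := exists_density_of_density_Ioo hY.integrable.aemeasurable hq
    hμ.isProbOnIco.isDensity_distortion hμ.integrableOn hYσ
  refine (hμ.isProbOnIco.integral_AVaR_le hY.integrable hYσ).trans ?_
  rw [← hYZ]
  refine (isLUB_EVaR hα hY).1 ⟨Z, ?_, rfl⟩
  rw [hZ.isFeasibleDensity_iff hα.2 hY.order hZq]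
  exact ⟨fun hp => (h1 (one_lt_conjExponent hp).le).trans (hμ.le_of_one_lt hp),
    fun hp => (hμ.ge_of_neg hp).trans (h2 (conjExponent_lt_one_of_neg hp).le)⟩

end Transfer

/-! ### From feasible densities to admissible measures -/

section AssociatedMeasure

variable {Ω : Type*} [MeasurableSpace Ω]

/-- The measure `P (Z > t) dt` on `(0, ∞)`, transported by the distribution function of `Z`. -/
noncomputable def associatedMeasure (P : Measure Ω) (Z : Ω → ℝ) : Measure ℝ :=
  ((volume.restrict (Ioi (0 : ℝ))).withDensity fun t => P {ω | t < Z ω}).map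
    fun t => P.real {ω | Z ω ≤ t}

variable {P : Measure Ω}

lemma associatedMeasure_congr {Z Z' : Ω → ℝ} (h : Z =ᵐ[P] Z') :
    associatedMeasure P Z = associatedMeasure P Z' := by
  have h1 : ∀ t, P {ω | t < Z ω} = P {ω | t < Z' ω} := fun t =>
    measure_congr (h.mono fun ω hω => by simp only [ofPred, hω])
  have h2 : ∀ t, P.real {ω | Z ω ≤ t} = P.real {ω | Z' ω ≤ t} := fun t =>
    measureReal_congr (h.mono fun ω hω => by simp only [ofPred, hω])
  simp only [associatedMeasure, h1, h2]

variable [IsProbabilityMeasure P] {Z : Ω → ℝ}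

lemma measurable_distributionFunction (P : Measure Ω) [IsProbabilityMeasure P] (Z : Ω → ℝ) :
    Measurable fun t => P.real {ω | Z ω ≤ t} :=
  Monotone.measurable fun _ _ h => measureReal_mono fun _ hω => le_trans hω h

lemma measurable_survivalFunction (P : Measure Ω) (Z : Ω → ℝ) :
    Measurable fun t => P {ω | t < Z ω} :=
  Antitone.measurable fun _ _ h => measure_mono fun _ hω => lt_of_le_of_lt h hω

lemma survival_eq (hZ : AEMeasurable Z P) (t : ℝ) :
    P.real {ω | t < Z ω} = 1 - P.real {ω | Z ω ≤ t} := by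
  have := probReal_compl_eq_one_sub₀ (μ := P) (s := {ω | Z ω ≤ t})
    (nullMeasurableSet_le hZ aemeasurable_const)
  rw [← this]
  congr 1
  ext ω
  simp

lemma integrable_associatedMeasure_iff {k : ℝ → ℝ}
    (hk : AEStronglyMeasurable k (associatedMeasure P Z)) :
    Integrable k (associatedMeasure P Z) ↔
      IntegrableOn (fun t => P.real {ω | t < Z ω} * k (P.real {ω | Z ω ≤ t})) (Ioi 0) := by
  unfold associatedMeasure at hk ⊢
  rw [integrable_map_measure hk (measurable_distributionFunction P Z).aemeasurable,
    integrable_withDensity_iff_integrable_smul' (measurable_survivalFunction P Z)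
      (Filter.Eventually.of_forall fun _ => measure_lt_top _ _)]
  rfl

lemma integral_associatedMeasure {k : ℝ → ℝ}
    (hk : AEStronglyMeasurable k (associatedMeasure P Z)) :
    ∫ v, k v ∂(associatedMeasure P Z) =
      ∫ t in Ioi 0, P.real {ω | t < Z ω} * k (P.real {ω | Z ω ≤ t}) := by
  unfold associatedMeasure at hk ⊢
  rw [integral_map (measurable_distributionFunction P Z).aemeasurable hk,
    integral_withDensity_eq_integral_toReal_smul (measurable_survivalFunction P Z)
      (Filter.Eventually.of_forall fun _ => measure_lt_top _ _)]
  rfl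

/-- The total mass is E Z by the layer-cake formula, and the weight P(Z > t) vanishes wherever the
distribution function equals one. -/
lemma IsDensity.isProbOnIco_associatedMeasure (hZ : IsDensity P Z) :
    IsProbOnIco (associatedMeasure P Z) := by
  have hF := measurable_distributionFunction P Z
  refine ⟨⟨?_⟩, ?_⟩
  · rw [associatedMeasure, Measure.map_apply hF MeasurableSet.univ, preimage_univ,
      withDensity_apply _ MeasurableSet.univ, Measure.restrict_univ,
      ← lintegral_eq_lintegral_meas_lt P hZ.nonneg hZ.integrable.aemeasurable,
      ← ofReal_integral_eq_lintegral_ofReal hZ.integrable hZ.nonneg, hZ.integral_eq_one]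
    simp
  · have hm : MeasurableSet (Ico (0 : ℝ) 1)ᶜ := measurableSet_Ico.compl
    rw [associatedMeasure, Measure.map_apply hF hm, withDensity_apply _ (hF hm)]
    refine setLIntegral_eq_zero (hF hm) fun t ht => ?_
    have h1 : 1 ≤ P.real {ω | Z ω ≤ t} := by
      by_contra! h
      exact ht ⟨measureReal_nonneg, h⟩
    have h2 := survival_eq hZ.integrable.aemeasurable t
    have h3 : P.real {ω | t < Z ω} = 0 := le_antisymm (by linarith) measureReal_nonneg
    exact (measureReal_eq_zero_iff).1 h3

lemma IsDensity.isAssociated_associatedMeasure (hZ : IsDensity P Z) :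
    IsAssociated P Z (associatedMeasure P Z) := by
  refine ⟨hZ.isProbOnIco_associatedMeasure, ?_⟩
  have hF := measurable_distributionFunction P Z
  have hZm := hZ.integrable.aemeasurable
  -- Only countably many u have a level set {F = u} of positive length. For the others {F ≤ u} and
  -- {F < u} agree up to a null set, and the latter meets (0, ∞) in (0, VaR_u(Z)).
  have hcount := Measure.countable_meas_level_set_pos (μ := volume.restrict (Ioi (0 : ℝ))) hF
  filter_upwards [compl_mem_ae_iff.2 (hcount.measure_zero volume)] with u hu hu01
  have hlev : (volume.restrict (Ioi (0 : ℝ))) {t | P.real {ω | Z ω ≤ t} = u} = 0 := by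
    by_contra h
    exact hu (pos_iff_ne_zero.2 h)
  have hk : AEStronglyMeasurable ((Icc 0 u).indicator fun v => 1 / (1 - v))
      (associatedMeasure P Z) :=
    (Measurable.indicator (by fun_prop) measurableSet_Icc).aestronglyMeasurable
  -- The weight 1 - F(t) cancels the factor 1 / (1 - v) at v = F(t).
  have hpt : ∀ t, P.real {ω | t < Z ω} *
      (Icc 0 u).indicator (fun v => 1 / (1 - v)) (P.real {ω | Z ω ≤ t})
        = {t | P.real {ω | Z ω ≤ t} ≤ u}.indicator (fun _ => (1 : ℝ)) t := by
    intro t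
    by_cases h : P.real {ω | Z ω ≤ t} ≤ u
    · rw [indicator_of_mem (show _ ∈ Icc 0 u from ⟨measureReal_nonneg, h⟩),
        indicator_of_mem (show t ∈ {t | P.real {ω | Z ω ≤ t} ≤ u} from h), survival_eq hZm]
      exact mul_one_div_cancel (by linarith [hu01.2])
    · rw [indicator_of_notMem (fun h' : _ ∈ Icc 0 u => h h'.2), mul_zero,
        indicator_of_notMem (show t ∉ {t | P.real {ω | Z ω ≤ t} ≤ u} from h)]
  have hms : MeasurableSet {t | P.real {ω | Z ω ≤ t} ≤ u} := measurableSet_le hF measurable_const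
  have hQ0 : 0 ≤ VaR P u Z := by
    by_contra! h
    obtain ⟨t, ht, ht0⟩ := exists_between h
    have h1 := (VaR_le_iff hZm hu01).1 ht.le
    have h2 : P.real {ω | Z ω ≤ t} = 0 := by
      rw [measureReal_eq_zero_iff]
      refine measure_mono_null (fun ω hω => ?_) hZ.nonneg
      simp only [mem_compl_iff, mem_ofPred_eq, not_le] at hω ⊢
      exact lt_of_le_of_lt hω ht0
    linarith [hu01.1]
  have hset : {t | P.real {ω | Z ω ≤ t} < u} ∩ Ioi 0 = Ioo 0 (VaR P u Z) := by
    ext t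
    simp only [mem_inter_iff, mem_ofPred_eq, mem_Ioi, mem_Ioo]
    rw [← not_le, ← VaR_le_iff hZm hu01, not_le, and_comm]
  have hae : {t | P.real {ω | Z ω ≤ t} ≤ u} =ᵐ[volume.restrict (Ioi (0 : ℝ))]
      {t | P.real {ω | Z ω ≤ t} < u} := by
    filter_upwards [compl_mem_ae_iff.2 hlev] with t ht
    have ht' : P.real {ω | Z ω ≤ t} ≠ u := ht
    exact propext ⟨fun h => lt_of_le_of_ne h ht', fun h => le_of_lt h⟩
  rw [distortion, ← integral_indicator measurableSet_Icc, integral_associatedMeasure hk]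
  simp_rw [hpt]
  rw [integral_indicator_const _ hms, smul_eq_mul, mul_one, measureReal_congr hae,
    measureReal_restrict_apply (measurableSet_lt hF measurable_const), hset,
    Real.volume_real_Ioo_of_le hQ0, sub_zero]

/-- If P(Z > t) > 0, the normalized indicator of {Z > t} is a density bounded by 1 / P(Z > t),
exactly the cap at level P(Z ≤ t). Otherwise both sides are zero. -/
lemma setIntegral_le_mul_AVaR (hZ : AEMeasurable Z P) {Y : Ω → ℝ} (hY : Integrable Y P)
    (t : ℝ) : ∫ ω, Y ω * {ω | t < Z ω}.indicator (fun _ => (1 : ℝ)) ω ∂P ≤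
      P.real {ω | t < Z ω} * AVaR P (P.real {ω | Z ω ≤ t}) Y := by
  set G := P.real {ω | t < Z ω} with hG
  have hm : NullMeasurableSet {ω | t < Z ω} P := nullMeasurableSet_lt aemeasurable_const hZ
  have hGF := survival_eq hZ t
  rw [← hG] at hGF
  have hG0 : 0 ≤ G := measureReal_nonneg
  rcases hG0.eq_or_lt with h0 | h0
  · rw [← h0, zero_mul]
    refine le_of_eq (integral_eq_zero_of_ae ?_)
    have h1 : P {ω | t < Z ω} = 0 := (measureReal_eq_zero_iff).1 h0.symm
    filter_upwards [compl_mem_ae_iff.2 h1] with ω hω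
    rw [indicator_of_notMem hω]
    simp
  · have hx : P.real {ω | Z ω ≤ t} ∈ Ico (0 : ℝ) 1 := ⟨measureReal_nonneg, by linarith⟩
    have hi : Integrable ({ω | t < Z ω}.indicator fun _ => (1 : ℝ)) P :=
      (integrable_const _).indicator₀ hm
    have h1 : IsDensity P fun ω => G⁻¹ * {ω | t < Z ω}.indicator (fun _ => (1 : ℝ)) ω := by
      refine ⟨hi.const_mul _, Filter.Eventually.of_forall fun ω => ?_, ?_⟩
      · exact mul_nonneg (inv_nonneg.2 h0.le) (indicator_nonneg (fun _ _ => zero_le_one) _)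
      · rw [integral_const_mul, integral_indicator₀ hm]
        simp only [integral_const, MeasurableSet.univ, measureReal_restrict_apply, univ_inter,
          smul_eq_mul, mul_one]
        exact inv_mul_cancel₀ h0.ne'
    have h2 := le_AVaR hY hx h1 (Filter.Eventually.of_forall fun ω => by
      rw [← hGF, one_div]
      refine mul_le_of_le_one_right (inv_nonneg.2 h0.le) ?_
      exact indicator_le_self' (fun _ _ => zero_le_one) ω)
    have h3 : ∫ ω, Y ω * (G⁻¹ * {ω | t < Z ω}.indicator (fun _ => (1 : ℝ)) ω) ∂P
        = G⁻¹ * ∫ ω, Y ω * {ω | t < Z ω}.indicator (fun _ => (1 : ℝ)) ω ∂P := by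
      rw [← integral_const_mul]
      congr 1
      ext ω
      ring
    rwa [h3, inv_mul_le_iff₀ h0] at h2

/-- Layer cake: Z is the integral of 1_{t < Z} over t > 0. Swap the integrals and apply the previous
bound for each t. -/
lemma integral_mul_le_integral_AVaR_of_measurable (hZm : Measurable Z) (hZ0 : ∀ ω, 0 ≤ Z ω)
    {Y : Ω → ℝ} (hY : Integrable Y P) (hYZ : Integrable (fun ω => Y ω * Z ω) P)
    (hA : Integrable (fun x => AVaR P x Y) (associatedMeasure P Z)) :
    ∫ ω, Y ω * Z ω ∂P ≤ ∫ x, AVaR P x Y ∂(associatedMeasure P Z) := by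
  set f : Ω → ℝ → ℝ := fun ω t => Y ω * {ω | t < Z ω}.indicator (fun _ => (1 : ℝ)) ω with hf
  have hind : ∀ ω t, {ω | t < Z ω}.indicator (fun _ => (1 : ℝ)) ω
      = (Iio (Z ω)).indicator (fun _ => (1 : ℝ)) t := fun ω t => rfl
  have hvol : ∀ ω, ∫ t in Ioi (0 : ℝ), (Iio (Z ω)).indicator (fun _ => (1 : ℝ)) t = Z ω := by
    intro ω
    rw [integral_indicator_const _ measurableSet_Iio,
      measureReal_restrict_apply measurableSet_Iio, Iio_inter_Ioi,
      Real.volume_real_Ioo_of_le (hZ0 ω)]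
    simp
  have hm : AEStronglyMeasurable (Function.uncurry f)
      (P.prod (volume.restrict (Ioi (0 : ℝ)))) := by
    refine hY.1.comp_fst.mul (Measurable.aestronglyMeasurable ?_)
    exact (measurable_const (a := (1 : ℝ))).indicator
      (measurableSet_lt measurable_snd (hZm.comp measurable_fst))
  have hint : Integrable (Function.uncurry f) (P.prod (volume.restrict (Ioi (0 : ℝ)))) := by
    rw [integrable_prod_iff hm]
    constructor
    · refine Filter.Eventually.of_forall fun ω => ?_
      simp only [Function.uncurry, hf, hind]
      refine Integrable.const_mul ?_ _
      rw [integrable_indicator_iff measurableSet_Iio, integrableOn_const_iff]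
      right
      rw [Measure.restrict_apply measurableSet_Iio, Iio_inter_Ioi]
      simp
    · refine hYZ.norm.congr (Filter.Eventually.of_forall fun ω => ?_)
      simp only [Function.uncurry, hf, hind, norm_mul, norm_indicator_eq_indicator_norm, norm_one]
      rw [integral_const_mul, hvol, Real.norm_of_nonneg (hZ0 ω)]
  have h1 : ∫ ω, Y ω * Z ω ∂P = ∫ t in Ioi (0 : ℝ), ∫ ω, f ω t ∂P := by
    rw [← integral_integral_swap hint]
    refine integral_congr_ae (Filter.Eventually.of_forall fun ω => ?_)
    simp only [hf, hind]
    rw [integral_const_mul, hvol]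
  rw [h1, integral_associatedMeasure hA.1]
  exact integral_mono_ae hint.integral_prod_right ((integrable_associatedMeasure_iff hA.1).1 hA)
    (Filter.Eventually.of_forall fun t => setIntegral_le_mul_AVaR hZm.aemeasurable hY t)

lemma IsDensity.integral_mul_le_integral_AVaR (hZ : IsDensity P Z) {Y : Ω → ℝ}
    (hY : Integrable Y P) (hYZ : Integrable (fun ω => Y ω * Z ω) P)
    (hA : Integrable (fun x => AVaR P x Y) (associatedMeasure P Z)) :
    ∫ ω, Y ω * Z ω ∂P ≤ ∫ x, AVaR P x Y ∂(associatedMeasure P Z) := by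
  have hZm := hZ.integrable.aemeasurable
  have h : Z =ᵐ[P] fun ω => max (hZm.mk Z ω) 0 := by
    filter_upwards [hZm.ae_eq_mk, hZ.nonneg] with ω h1 h2
    rw [← h1, max_eq_left h2]
  have h1 : (fun ω => Y ω * Z ω) =ᵐ[P] fun ω => Y ω * max (hZm.mk Z ω) 0 :=
    h.mono fun ω hω => by simp only [hω]
  rw [associatedMeasure_congr h] at hA ⊢
  rw [integral_congr_ae h1]
  exact integral_mul_le_integral_AVaR_of_measurable (hZm.measurable_mk.max measurable_const)
    (fun ω => le_max_right _ _) hY (hYZ.congr h1) hA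

/-- The quantile function of Z has the law of Z, so the distortion inherits its moment. -/
lemma IsAssociated.isAdmissible {μ : Measure ℝ} {p α : ℝ} (hp : 1 < p ∨ p < 0) (hα : α < 1)
    (hZ : IsFeasibleDensity P p α Z) (hμ : IsAssociated P Z μ) : IsAdmissible p α μ := by
  have hD := hZ.isDensity
  have hZm := hD.integrable.aemeasurable
  have hg : Measurable fun z : ℝ => z ^ p.conjExponent := measurable_id.pow_const _
  have h1 : (fun u => VaR P u Z ^ p.conjExponent)
      =ᵐ[volume.restrict (Ioo (0 : ℝ) 1)] fun u => distortion μ u ^ p.conjExponent := by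
    filter_upwards [(ae_restrict_iff' measurableSet_Ioo).2 hμ.2] with u hu
    rw [hu]
  have h2 : ∫ u in Ioo (0 : ℝ) 1, distortion μ u ^ p.conjExponent
      = ∫ ω, Z ω ^ p.conjExponent ∂P := by
    rw [← integral_congr_ae h1, integral_comp_VaR hZm hg]
  have h3 := (hD.isFeasibleDensity_iff hα hp hZ.integrable_rpow).1 hZ
  refine ⟨hμ.1, ((integrable_comp_VaR_iff hZm hg).2 hZ.integrable_rpow).congr h1, ?_, ?_⟩
  · rw [h2]; exact h3.1
  · rw [h2]; exact h3.2

end AssociatedMeasure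

/-! ### A measure is determined by its distortion function -/

section Uniqueness

variable {μ ν : Measure ℝ}

/-- Integration by parts: the distribution function in terms of the distortion function. -/
lemma IsProbOnIco.measureReal_Iic (hμ : IsProbOnIco μ) {a : ℝ} (ha : a ∈ Ioo (0 : ℝ) 1) :
    μ.real (Iic a) = (1 - a) * distortion μ a + ∫ u in Ioo 0 a, distortion μ u := by
  have := hμ.isProbabilityMeasure
  have hfm : AEStronglyMeasurable ((Iio a).indicator fun _ => (1 : ℝ))
      (volume.restrict (Ioo (0 : ℝ) 1)) :=
    (measurable_const.indicator measurableSet_Iio).aestronglyMeasurable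
  have hmul : ∀ u, (Iio a).indicator (fun _ => (1 : ℝ)) u * distortion μ u
      = (Iio a).indicator (distortion μ) u := by
    intro u
    by_cases h : u ∈ Iio a <;> simp [h]
  have hfσ : IntegrableOn (fun u => (Iio a).indicator (fun _ => (1 : ℝ)) u * distortion μ u)
      (Ioo (0 : ℝ) 1) := by
    simp_rw [hmul]
    exact hμ.integrableOn_distortion.indicator measurableSet_Iio
  have hset : Ioo (0 : ℝ) 1 ∩ Iio a = Ioo 0 a := by
    ext u
    simp only [mem_inter_iff, mem_Ioo, mem_Iio]
    exact ⟨fun h => ⟨h.1.1, h.2⟩, fun h => ⟨⟨h.1, h.2.trans ha.2⟩, h.2⟩⟩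
  -- The tail average of the indicator of (-∞, a) is (a - v)⁺ / (1 - v). For v ≤ a, adding (1 - a) /
  -- (1 - v) gives 1; for v > a both terms vanish.
  have h1 : ∫ u in Ioo 0 a, distortion μ u
      = ∫ v, (1 / (1 - v) * ∫ u in Ioo v 1, (Iio a).indicator (fun _ => (1 : ℝ)) u) ∂μ := by
    rw [hμ.integral_tail_average hfm hfσ]
    simp_rw [hmul]
    rw [setIntegral_indicator measurableSet_Iio, hset]
  have hmi := hμ.integrable_tail_average hfm hfσ
  rw [h1, ← hμ.integral_distortionKernel, ← integral_const_mul,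
    ← integral_add ((hμ.integrable_distortionKernel ha.2).const_mul _) hmi]
  have h2 : μ.real (Iic a) = ∫ v, (Iic a).indicator (fun _ => (1 : ℝ)) v ∂μ := by
    rw [integral_indicator_const _ measurableSet_Iic, smul_eq_mul, mul_one]
  rw [h2]
  refine integral_congr_ae (hμ.ae_mem.mono fun v hv => ?_)
  have hv1 : (1 : ℝ) - v ≠ 0 := by linarith [hv.2]
  have hset2 : Ioo v 1 ∩ Iio a = Ioo v a := by
    ext u
    simp only [mem_inter_iff, mem_Ioo, mem_Iio]
    exact ⟨fun h => ⟨h.1.1, h.2⟩, fun h => ⟨⟨h.1, h.2.trans ha.2⟩, h.2⟩⟩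
  have h3 : ∫ u in Ioo v 1, (Iio a).indicator (fun _ => (1 : ℝ)) u = max (a - v) 0 := by
    rw [setIntegral_indicator measurableSet_Iio, hset2]
    simp [Measure.real, ENNReal.toReal_ofReal']
  simp only
  rw [h3]
  unfold distortionKernel
  by_cases h : v ≤ a
  · rw [indicator_of_mem (show v ∈ Iic a from h), if_pos h, max_eq_left (by linarith)]
    field_simp
    ring
  · rw [indicator_of_notMem (show v ∉ Iic a from h), if_neg h, max_eq_right (by linarith)]
    ring

/-- Points of agreement accumulate at every x from the right, and both functions are
right-continuous. -/
lemma StieltjesFunction_eq_of_ae_eq {F G : StieltjesFunction ℝ} (h : ∀ᵐ x, F x = G x) :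
    F = G := by
  ext x
  have hF := (F.right_continuous x).mono_left (nhdsWithin_mono x Ioi_subset_Ici_self)
  have hG := (G.right_continuous x).mono_left (nhdsWithin_mono x Ioi_subset_Ici_self)
  have hfreq : ∃ᶠ y in nhdsWithin x (Ioi x), F y = G y := by
    rw [Filter.Frequently]
    intro hne
    obtain ⟨b, hb, hsub⟩ := (mem_nhdsGT_iff_exists_Ioo_subset).1 hne
    have h0 : volume (Ioo x b) = 0 := measure_mono_null hsub (by
      have h1 : volume {y | ¬ F y = G y} = 0 := h
      exact h1)
    rw [Real.volume_Ioo, ENNReal.ofReal_eq_zero] at h0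
    have : x < b := hb
    linarith
  exact tendsto_nhds_unique_of_frequently_eq hF hG hfreq

lemma IsProbOnIco.ext_of_distortion_ae_eq (hμ : IsProbOnIco μ) (hν : IsProbOnIco ν)
    (h : ∀ᵐ u, u ∈ Ioo (0 : ℝ) 1 → distortion μ u = distortion ν u) : μ = ν := by
  have := hμ.isProbabilityMeasure
  have := hν.isProbabilityMeasure
  refine Measure.eq_of_cdf μ ν (StieltjesFunction_eq_of_ae_eq ?_)
  have hneg : ∀ {ρ : Measure ℝ}, IsProbOnIco ρ → ∀ a < 0, ρ.real (Iic a) = 0 := by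
    intro ρ hρ a ha
    have := hρ.isProbabilityMeasure
    rw [measureReal_eq_zero_iff]
    refine measure_mono_null (fun v (hv : v ≤ a) => ?_) hρ.compl_null
    exact fun hv' : v ∈ Ico (0 : ℝ) 1 => by linarith [hv'.1]
  have hge : ∀ {ρ : Measure ℝ}, IsProbOnIco ρ → ∀ a, 1 ≤ a → ρ.real (Iic a) = 1 := by
    intro ρ hρ a ha
    have := hρ.isProbabilityMeasure
    have h1 : Iic a =ᵐ[ρ] univ :=
      Filter.eventuallyEq_univ.2 (hρ.ae_mem.mono fun v hv => hv.2.le.trans ha)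
    rw [measureReal_congr h1, probReal_univ]
  filter_upwards [h, Measure.ae_ne volume (0 : ℝ)] with a ha ha0
  rw [ProbabilityTheory.cdf_eq_real, ProbabilityTheory.cdf_eq_real]
  rcases lt_or_gt_of_ne ha0 with h0 | h0
  · rw [hneg hμ a h0, hneg hν a h0]
  rcases le_or_gt 1 a with h1 | h1
  · rw [hge hμ a h1, hge hν a h1]
  rw [hμ.measureReal_Iic ⟨h0, h1⟩, hν.measureReal_Iic ⟨h0, h1⟩, ha ⟨h0, h1⟩]
  congr 1
  refine setIntegral_congr_ae measurableSet_Ioo (h.mono fun u hu hu' => hu ⟨hu'.1, ?_⟩)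
  exact hu'.2.trans h1

lemma IsAssociated.unique {Ω : Type*} [MeasurableSpace Ω] {P : Measure Ω} {Z : Ω → ℝ}
    (hμ : IsAssociated P Z μ) (hν : IsAssociated P Z ν) : μ = ν :=
  hμ.1.ext_of_distortion_ae_eq hν.1 (by
    filter_upwards [hμ.2, hν.2] with u h1 h2 hu
    rw [h1 hu, h2 hu])

end Uniqueness

/-! ### Lagrangian sufficiency for p > 1 -/

section Optimality

variable {Ω : Type*} [MeasurableSpace Ω] {P : Measure Ω} [IsProbabilityMeasure P]
  {p α : ℝ} {Y Z : Ω → ℝ}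

lemma IsFeasibleDensity.isOptimalDensity (hα : α ∈ Ico (0 : ℝ) 1) (hY : HasMoment P p Y)
    (hZ : IsFeasibleDensity P p α Z)
    (h : ∀ Z', IsFeasibleDensity P p α Z' → ∫ ω, Y ω * Z' ω ∂P ≤ ∫ ω, Y ω * Z ω ∂P) :
    IsOptimalDensity P p α Y Z := by
  refine ⟨hZ, le_antisymm ((isLUB_EVaR hα hY).1 ⟨Z, hZ, rfl⟩) ((isLUB_EVaR hα hY).2 ?_)⟩
  rintro r ⟨Z', hZ', rfl⟩
  exact h Z' hZ'

lemma rpow_sub_one_mul_le (hp : 1 < p) {x z : ℝ} (hx : 0 ≤ x) (hz : 0 ≤ z) :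
    x ^ (p.conjExponent - 1) * z ≤
      x ^ p.conjExponent / p + z ^ p.conjExponent / p.conjExponent := by
  have hpq := Real.HolderConjugate.conjExponent hp
  have h := Real.young_inequality_of_nonneg (Real.rpow_nonneg hx (p.conjExponent - 1)) hz hpq
  have h1 : (p.conjExponent - 1) * p = p.conjExponent := by
    rw [hpq.symm.sub_one_mul_conj]
  rwa [← Real.rpow_mul hx, h1] at h

/-- A Lagrangian criterion for optimality, with multiplier `c` for the constraint `E Z = 1` and
`s` for the entropy constraint. -/
lemma IsFeasibleDensity.isOptimalDensity_of_multipliers (hα : α ∈ Ico (0 : ℝ) 1) (hp : 1 < p)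
    (hY : HasMoment P p Y) (hZ : IsFeasibleDensity P p α Z) {c s : ℝ} (hs : 0 ≤ s)
    (hle : ∀ᵐ ω ∂P, Y ω - c ≤ s * Z ω ^ (p.conjExponent - 1))
    (heq : ∀ᵐ ω ∂P, (Y ω - c) * Z ω = s * Z ω ^ p.conjExponent)
    (hslack : s * (1 / (1 - α)) ^ (p.conjExponent - 1) ≤ s * ∫ ω, Z ω ^ p.conjExponent ∂P) :
    IsOptimalDensity P p α Y Z := by
  have hpq := Real.HolderConjugate.conjExponent hp
  have hq : 0 < p.conjExponent := conjExponent_pos (Or.inl hp)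
  refine hZ.isOptimalDensity hα hY fun Z' hZ' => ?_
  have hD := hZ.isDensity
  have hD' := hZ'.isDensity
  have hYZ := hY.integrable_mul hD.integrable hD.nonneg hZ.integrable_rpow
  have hYZ' := hY.integrable_mul hD'.integrable hD'.nonneg hZ'.integrable_rpow
  have hb := ((hD'.isFeasibleDensity_iff hα.2 (Or.inl hp) hZ'.integrable_rpow).1 hZ').1 hp
  set E := ∫ ω, Z ω ^ p.conjExponent ∂P
  set E' := ∫ ω, Z' ω ^ p.conjExponent ∂P
  have h1 : ∫ ω, Y ω * Z ω ∂P = c + s * E := by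
    have : ∫ ω, Y ω * Z ω ∂P = ∫ ω, (c * Z ω + s * Z ω ^ p.conjExponent) ∂P :=
      integral_congr_ae (heq.mono fun ω h => by simp only; linarith)
    rw [this, integral_add (hD.integrable.const_mul c) (hZ.integrable_rpow.const_mul s),
      integral_const_mul, integral_const_mul, hD.integral_eq_one, mul_one]
  have hsum : Integrable (fun ω =>
      s * (Z ω ^ p.conjExponent / p + Z' ω ^ p.conjExponent / p.conjExponent)) P :=
    ((hZ.integrable_rpow.div_const p).add (hZ'.integrable_rpow.div_const _)).const_mul s
  -- Young's inequality decouples Z ^ (q - 1) * Z' into q-th moments with weights 1/p and 1/q, which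
  -- sum to one. Feasibility of Z' and slackness then bring the bound back to s * E.
  have h2 : ∫ ω, Y ω * Z' ω ∂P ≤ c + s * (E / p + E' / p.conjExponent) := by
    have h3 : ∫ ω, Y ω * Z' ω ∂P ≤ ∫ ω, (c * Z' ω +
        s * (Z ω ^ p.conjExponent / p + Z' ω ^ p.conjExponent / p.conjExponent)) ∂P := by
      refine integral_mono_ae hYZ' ((hD'.integrable.const_mul c).add hsum) ?_
      filter_upwards [hle, hD.nonneg, hD'.nonneg] with ω h4 h5 h6
      have h7 := mul_le_mul_of_nonneg_right h4 h6
      have h8 := mul_le_mul_of_nonneg_left (rpow_sub_one_mul_le hp h5 h6) hs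
      linarith
    rwa [integral_add (hD'.integrable.const_mul c) hsum,
      integral_const_mul, integral_const_mul, hD'.integral_eq_one, mul_one,
      integral_add (hZ.integrable_rpow.div_const p) (hZ'.integrable_rpow.div_const _),
      integral_div, integral_div] at h3
  have h4 : s * E' ≤ s * E := (mul_le_mul_of_nonneg_left hb hs).trans hslack
  have h5 : s * (E / p + E' / p.conjExponent) ≤ s * E := by
    have h6 : s * E' / p.conjExponent ≤ s * E / p.conjExponent := by gcongr
    have h7 : s * E / p + s * E / p.conjExponent = s * E := by
      have := hpq.inv_add_inv_eq_one
      rw [div_eq_mul_inv, div_eq_mul_inv, ← mul_add, this, mul_one]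
    have h8 : s * (E / p + E' / p.conjExponent) = s * E / p + s * E' / p.conjExponent := by ring
    linarith
  linarith

lemma rpow_sub_one_le_one_add {x r : ℝ} (hx : 0 ≤ x) (hr : 1 < r) : x ^ (r - 1) ≤ 1 + x ^ r := by
  rcases le_total x 1 with h | h
  · linarith [Real.rpow_le_one hx h (by linarith : 0 ≤ r - 1), Real.rpow_nonneg hx r]
  · linarith [Real.rpow_le_rpow_of_exponent_le h (by linarith : r - 1 ≤ r)]

lemma integrable_abs_add_rpow (hp : 1 < p) (hY : MemLp Y (ENNReal.ofReal p) P) (K : ℝ) :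
    Integrable (fun ω => (|Y ω| + |K|) ^ p) P := by
  have h := integrable_abs_rpow (by linarith) (hY.norm.add (memLp_const (|K|)))
  refine h.congr (Filter.Eventually.of_forall fun ω => ?_)
  simp only [Pi.add_apply, Real.norm_eq_abs]
  rw [abs_of_nonneg (by positivity)]

lemma integrable_abs_add_rpow_sub_one (hp : 1 < p) (hY : MemLp Y (ENNReal.ofReal p) P) (K : ℝ) :
    Integrable (fun ω => (|Y ω| + |K|) ^ (p - 1)) P := by
  refine ((integrable_const 1).add (integrable_abs_add_rpow hp hY K)).mono' ?_ ?_
  · exact ((hY.1.aemeasurable.norm.add_const _).pow_const _).aestronglyMeasurable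
  · refine Filter.Eventually.of_forall fun ω => ?_
    have h : 0 ≤ |Y ω| + |K| := by positivity
    rw [Real.norm_of_nonneg (Real.rpow_nonneg h _)]
    exact rpow_sub_one_le_one_add h hp

end Optimality

/-! ### A path of truncations -/

section Truncation

variable {Ω : Type*} [MeasurableSpace Ω] {P : Measure Ω} {Y : Ω → ℝ}

/-- The path from the constant `1` to `(Y - c)⁺`. -/
noncomputable def truncationPath (c t y : ℝ) : ℝ := max (t * (y - c) + (1 - t)) 0

/-- A majorant independent of t, for dominated convergence along the path; the outer absolute value
matches `integrable_abs_add_rpow` with constant |c| + 1. -/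
lemma truncationPath_le {c t y : ℝ} (ht : t ∈ Icc (0 : ℝ) 1) :
    truncationPath c t y ≤ |y| + |(|c| + 1)| := by
  rw [abs_of_nonneg (by positivity : 0 ≤ |c| + 1)]
  refine max_le ?_ (by positivity)
  have h1 : y - c ≤ |y| + |c| := by linarith [le_abs_self y, neg_abs_le c]
  have h2 : t * (y - c) ≤ 1 * (|y| + |c|) :=
    (mul_le_mul_of_nonneg_left h1 ht.1).trans (mul_le_mul_of_nonneg_right ht.2 (by positivity))
  linarith [ht.1]

lemma measurable_truncationPath (c t : ℝ) : Measurable (truncationPath c t) := by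
  unfold truncationPath; fun_prop

lemma truncationPath_nonneg (c t y : ℝ) : 0 ≤ truncationPath c t y := le_max_right _ _

lemma integrable_truncationPath_rpow {r c t : ℝ} (hr : 0 ≤ r) (hY : AEMeasurable Y P)
    (hi : Integrable (fun ω => (|Y ω| + |(|c| + 1)|) ^ r) P) (ht : t ∈ Icc (0 : ℝ) 1) :
    Integrable (fun ω => truncationPath c t (Y ω) ^ r) P := by
  refine hi.mono' (((measurable_truncationPath c t).pow_const r).comp_aemeasurable
    hY).aestronglyMeasurable (Filter.Eventually.of_forall fun ω => ?_)
  rw [Real.norm_of_nonneg (Real.rpow_nonneg (truncationPath_nonneg _ _ _) _)]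
  exact Real.rpow_le_rpow (truncationPath_nonneg _ _ _) (truncationPath_le ht) hr

lemma integral_rpow_pos_of_measure_pos {W : Ω → ℝ} {r : ℝ} (hW : ∀ ω, 0 ≤ W ω)
    (hi : Integrable (fun ω => W ω ^ r) P) {S : Set Ω} (hS : P S ≠ 0) (hpos : ∀ ω ∈ S, 0 < W ω) :
    0 < ∫ ω, W ω ^ r ∂P := by
  rw [integral_pos_iff_support_of_nonneg (fun ω => Real.rpow_nonneg (hW ω) r) hi]
  refine lt_of_lt_of_le (pos_iff_ne_zero.2 hS) (measure_mono fun ω hω => ?_)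
  exact (Real.rpow_pos_of_pos (hpos ω hω) r).ne'

lemma continuousOn_integral_truncationPath {r c : ℝ} (hr : 0 ≤ r) (hY : AEMeasurable Y P)
    (hi : Integrable (fun ω => (|Y ω| + |(|c| + 1)|) ^ r) P) :
    ContinuousOn (fun t => ∫ ω, truncationPath c t (Y ω) ^ r ∂P) (Icc 0 1) := by
  refine continuousOn_of_dominated (bound := fun ω => (|Y ω| + |(|c| + 1)|) ^ r) ?_ ?_ hi ?_
  · exact fun t ht => (integrable_truncationPath_rpow hr hY hi ht).1
  · refine fun t ht => Filter.Eventually.of_forall fun ω => ?_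
    rw [Real.norm_of_nonneg (Real.rpow_nonneg (truncationPath_nonneg _ _ _) _)]
    exact Real.rpow_le_rpow (truncationPath_nonneg _ _ _) (truncationPath_le ht) hr
  · refine Filter.Eventually.of_forall fun ω => Continuous.continuousOn ?_
    refine Continuous.rpow_const ?_ fun _ => Or.inr hr
    unfold truncationPath
    fun_prop

end Truncation

/-! ### Existence of an optimal density for p > 1 -/

section Existence

variable {Ω : Type*} [MeasurableSpace Ω] {P : Measure Ω} [IsProbabilityMeasure P]
  {p α : ℝ} {Y : Ω → ℝ}

/-- An optimal density proportional to `((Y - c)⁺) ^ (p - 1)`. -/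
lemma exists_isOptimalDensity_of_le (hα : α ∈ Ioo (0 : ℝ) 1) (hp : 1 < p)
    (hYp : MemLp Y (ENNReal.ofReal p) P) {c : ℝ} (hc : P {ω | c < Y ω} ≠ 0)
    (h : (1 / (1 - α)) ^ (p.conjExponent - 1) *
        (∫ ω, truncationPath c 1 (Y ω) ^ (p - 1) ∂P) ^ p.conjExponent
      ≤ ∫ ω, truncationPath c 1 (Y ω) ^ p ∂P) :
    ∃ Z, IsOptimalDensity P p α Y Z := by
  have hpq := Real.HolderConjugate.conjExponent hp
  have hq : 1 < p.conjExponent := one_lt_conjExponent hp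
  have hq1 : (p - 1) * p.conjExponent = p := hpq.sub_one_mul_conj
  have hYm := hYp.1.aemeasurable
  have hi1 := integrable_abs_add_rpow hp hYp (|c| + 1)
  have hi2 := integrable_abs_add_rpow_sub_one hp hYp (|c| + 1)
  have hB : 1 < (1 / (1 - α)) ^ (p.conjExponent - 1) := by
    refine Real.one_lt_rpow ?_ (by linarith)
    rw [lt_div_iff₀ (by linarith [hα.2])]
    linarith [hα.1]
  set B := (1 / (1 - α)) ^ (p.conjExponent - 1) with hBdef
  set M : ℝ → ℝ := fun t => ∫ ω, truncationPath c t (Y ω) ^ p ∂P with hM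
  set N : ℝ → ℝ := fun t => ∫ ω, truncationPath c t (Y ω) ^ (p - 1) ∂P with hN
  have hMc : ContinuousOn M (Icc 0 1) :=
    continuousOn_integral_truncationPath (by linarith) hYm hi1
  have hNc : ContinuousOn N (Icc 0 1) :=
    continuousOn_integral_truncationPath (by linarith) hYm hi2
  have hDc : ContinuousOn (fun t => M t - B * N t ^ p.conjExponent) (Icc 0 1) :=
    hMc.sub (continuousOn_const.mul (hNc.rpow_const fun _ _ => Or.inr (by linarith)))
  -- The normalized power of the path has q-th moment M / N ^ q. At t = 0 the density is 1, with
  -- moment 1 < B; at t = 1 the bound B is reached by hypothesis. In between the constraint becomes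
  -- active.
  have hD0 : M 0 - B * N 0 ^ p.conjExponent < 0 := by
    simp only [hM, hN, truncationPath]
    simp
    exact hB
  have hD1 : 0 ≤ M 1 - B * N 1 ^ p.conjExponent := by linarith
  obtain ⟨t, ht, htD⟩ := intermediate_value_Icc zero_le_one hDc ⟨hD0.le, hD1⟩
  have ht0 : 0 < t := by
    rcases ht.1.eq_or_lt with h0 | h0
    · rw [← h0] at htD
      exact absurd htD hD0.ne
    · exact h0
  have hMt : M t = B * N t ^ p.conjExponent := by
    simp only at htD
    linarith
  set W : Ω → ℝ := fun ω => truncationPath c t (Y ω) with hW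
  have hW0 : ∀ ω, 0 ≤ W ω := fun ω => truncationPath_nonneg _ _ _
  have hWi : Integrable (fun ω => W ω ^ (p - 1)) P :=
    integrable_truncationPath_rpow (by linarith) hYm hi2 ht
  have hWi' : Integrable (fun ω => W ω ^ p) P :=
    integrable_truncationPath_rpow (by linarith) hYm hi1 ht
  have hA : 0 < N t := by
    refine integral_rpow_pos_of_measure_pos hW0 hWi hc fun ω (hω : c < Y ω) => ?_
    have h1 : 0 < t * (Y ω - c) := mul_pos ht0 (by linarith)
    exact lt_max_of_lt_left (by linarith [ht.2])
  set A := N t with hAdef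
  have hpow : ∀ ω, (A⁻¹ * W ω ^ (p - 1)) ^ p.conjExponent
      = (A ^ p.conjExponent)⁻¹ * W ω ^ p := by
    intro ω
    rw [Real.mul_rpow (inv_nonneg.2 hA.le) (Real.rpow_nonneg (hW0 ω) _), Real.inv_rpow hA.le,
      ← Real.rpow_mul (hW0 ω), hq1]
  have hpow' : ∀ ω, (A⁻¹ * W ω ^ (p - 1)) ^ (p.conjExponent - 1)
      = (A ^ (p.conjExponent - 1))⁻¹ * W ω := by
    intro ω
    have h2 : (p - 1) * (p.conjExponent - 1) = 1 := by linarith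
    rw [Real.mul_rpow (inv_nonneg.2 hA.le) (Real.rpow_nonneg (hW0 ω) _), Real.inv_rpow hA.le,
      ← Real.rpow_mul (hW0 ω), h2, Real.rpow_one]
  have hD : IsDensity P fun ω => A⁻¹ * W ω ^ (p - 1) := by
    refine ⟨hWi.const_mul _, Filter.Eventually.of_forall fun ω =>
      mul_nonneg (inv_nonneg.2 hA.le) (Real.rpow_nonneg (hW0 ω) _), ?_⟩
    rw [integral_const_mul]
    exact inv_mul_cancel₀ hA.ne'
  have hZq : Integrable (fun ω => (A⁻¹ * W ω ^ (p - 1)) ^ p.conjExponent) P := by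
    simp_rw [hpow]
    exact hWi'.const_mul _
  have hE : ∫ ω, (A⁻¹ * W ω ^ (p - 1)) ^ p.conjExponent ∂P = B := by
    simp_rw [hpow]
    rw [integral_const_mul]
    have h3 : ∫ ω, W ω ^ p ∂P = B * A ^ p.conjExponent := hMt
    have h4 := (Real.rpow_pos_of_pos hA p.conjExponent).ne'
    rw [h3]
    field_simp
  have hfeas : IsFeasibleDensity P p α fun ω => A⁻¹ * W ω ^ (p - 1) := by
    rw [hD.isFeasibleDensity_iff hα.2 (Or.inl hp) hZq, hE]
    exact ⟨fun _ => le_rfl, fun h => absurd h (by linarith)⟩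
  have hs : 0 < A ^ (p.conjExponent - 1) := Real.rpow_pos_of_pos hA _
  have hAmul : A ^ p.conjExponent = A ^ (p.conjExponent - 1) * A := by
    rw [← Real.rpow_add_one hA.ne', sub_add_cancel]
  -- For t > 0 the path equals t (Y - c')⁺ with c' = c - (1 - t) / t, the first multiplier. Since (p
  -- - 1)(q - 1) = 1, Z ^ (q - 1) = W / A ^ (q - 1), which dictates s.
  refine ⟨_, hfeas.isOptimalDensity_of_multipliers ⟨hα.1.le, hα.2⟩ hp (Or.inl ⟨hp, hYp⟩)
    (c := c - (1 - t) / t) (s := A ^ (p.conjExponent - 1) / t) (div_nonneg hs.le ht0.le) ?_ ?_ ?_⟩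
  · refine Filter.Eventually.of_forall fun ω => ?_
    rw [hpow']
    have h5 : A ^ (p.conjExponent - 1) / t * ((A ^ (p.conjExponent - 1))⁻¹ * W ω) = W ω / t := by
      field_simp
    rw [h5, le_div_iff₀ ht0]
    refine le_trans (le_of_eq ?_) (le_max_left (t * (Y ω - c) + (1 - t)) 0)
    field_simp
    ring
  · refine Filter.Eventually.of_forall fun ω => ?_
    rw [hpow, hAmul]
    have h5 : A ^ (p.conjExponent - 1) / t *
        ((A ^ (p.conjExponent - 1) * A)⁻¹ * W ω ^ p) = A⁻¹ / t * W ω ^ p := by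
      field_simp
    rw [h5]
    rcases (hW0 ω).eq_or_lt with h0 | h0
    · rw [← h0, Real.zero_rpow (by linarith), Real.zero_rpow (by linarith)]
      simp
    · have h6 : W ω = t * (Y ω - c) + (1 - t) := by
        refine max_eq_left ?_
        by_contra! h7
        exact h0.ne' (max_eq_right h7.le)
      have h7 : Y ω - (c - (1 - t) / t) = W ω / t := by
        rw [h6]
        field_simp
        ring
      have h8 : W ω ^ p = W ω ^ (p - 1) * W ω := by
        rw [← Real.rpow_add_one h0.ne', sub_add_cancel]
      rw [h7, h8]
      ring
  · rw [hE]

/-- With π = P(Y > c), Hölder against the indicator of {Y > c} gives N ^ q ≤ M π ^ (q - 1). Combined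
with the hypothesis this forces (π / (1 - α)) ^ (q - 1) > 1. -/
lemma measureReal_gt_of_lt (hα : α ∈ Ioo (0 : ℝ) 1) (hp : 1 < p)
    (hYp : MemLp Y (ENNReal.ofReal p) P) {c : ℝ}
    (h : ∫ ω, truncationPath c 1 (Y ω) ^ p ∂P <
      (1 / (1 - α)) ^ (p.conjExponent - 1) *
        (∫ ω, truncationPath c 1 (Y ω) ^ (p - 1) ∂P) ^ p.conjExponent) :
    1 - α < P.real {ω | c < Y ω} := by
  have hpq := Real.HolderConjugate.conjExponent hp
  have hq : 1 < p.conjExponent := one_lt_conjExponent hp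
  have hq1 : (p - 1) * p.conjExponent = p := hpq.sub_one_mul_conj
  have hYm := hYp.1.aemeasurable
  have hi1 := integrable_truncationPath_rpow (c := c) (t := 1) (by linarith) hYm
    (integrable_abs_add_rpow hp hYp (|c| + 1)) (by simp)
  have hi2 := integrable_truncationPath_rpow (c := c) (t := 1) (by linarith) hYm
    (integrable_abs_add_rpow_sub_one hp hYp (|c| + 1)) (by simp)
  set W : Ω → ℝ := fun ω => truncationPath c 1 (Y ω) with hW
  have hW0 : ∀ ω, 0 ≤ W ω := fun ω => truncationPath_nonneg _ _ _
  have hm : NullMeasurableSet {ω | c < Y ω} P := nullMeasurableSet_lt aemeasurable_const hYm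
  set S := {ω | c < Y ω} with hS
  have hpow : ∀ ω, (W ω ^ (p - 1)) ^ p.conjExponent = W ω ^ p := fun ω => by
    rw [← Real.rpow_mul (hW0 ω), hq1]
  have hWS : ∀ ω, W ω ^ (p - 1) * S.indicator (fun _ => (1 : ℝ)) ω = W ω ^ (p - 1) := by
    intro ω
    by_cases hω : ω ∈ S
    · simp [hω]
    · have h1 : W ω = 0 := max_eq_right (by
        have : Y ω ≤ c := not_lt.1 hω
        linarith)
      rw [h1, Real.zero_rpow (by linarith), zero_mul]
  have hSp : ∀ ω, S.indicator (fun _ => (1 : ℝ)) ω ^ p = S.indicator (fun _ => (1 : ℝ)) ω := by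
    intro ω
    by_cases hω : ω ∈ S
    · simp [hω]
    · simp [hω, Real.zero_rpow (by linarith : p ≠ 0)]
  have hSi : Integrable (S.indicator fun _ => (1 : ℝ)) P := (integrable_const _).indicator₀ hm
  have hH := integral_mul_le_Lp_mul_Lq_of_nonneg (μ := P) hpq.symm
    (f := fun ω => W ω ^ (p - 1)) (g := S.indicator fun _ => (1 : ℝ))
    (Filter.Eventually.of_forall fun ω => Real.rpow_nonneg (hW0 ω) _)
    (Filter.Eventually.of_forall fun ω => indicator_nonneg (fun _ _ => zero_le_one) ω) ?_ ?_
  rotate_left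
  · rw [← integrable_norm_rpow_iff hi2.1 (by simp; linarith) ENNReal.ofReal_ne_top,
      ENNReal.toReal_ofReal (by linarith)]
    refine hi1.congr (Filter.Eventually.of_forall fun ω => ?_)
    simp only
    rw [Real.norm_of_nonneg (Real.rpow_nonneg (hW0 ω) _), hpow]
  · refine MemLp.of_bound hSi.1 1 (Filter.Eventually.of_forall fun ω => ?_)
    rw [norm_indicator_eq_indicator_norm, norm_one]
    exact indicator_le_self' (fun _ _ => zero_le_one) ω
  have hSint : ∫ ω, S.indicator (fun _ => (1 : ℝ)) ω ∂P = P.real S := by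
    rw [integral_indicator₀ hm]
    simp
  simp only [hWS, hpow, hSp, hSint] at hH
  set M := ∫ ω, W ω ^ p ∂P with hM
  set N := ∫ ω, W ω ^ (p - 1) ∂P with hN
  set π := P.real S with hπ
  have hM0 : 0 ≤ M := integral_nonneg fun ω => Real.rpow_nonneg (hW0 ω) _
  have hN0 : 0 ≤ N := integral_nonneg fun ω => Real.rpow_nonneg (hW0 ω) _
  have hπ0 : 0 ≤ π := measureReal_nonneg
  have h1 : N ^ p.conjExponent ≤ M * π ^ (p.conjExponent - 1) := by
    have h2 := Real.rpow_le_rpow hN0 hH (by linarith : 0 ≤ p.conjExponent)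
    rw [Real.mul_rpow (Real.rpow_nonneg hM0 _) (Real.rpow_nonneg hπ0 _), ← Real.rpow_mul hM0,
      ← Real.rpow_mul hπ0, one_div_mul_cancel (by linarith), Real.rpow_one] at h2
    have h3 : 1 / p * p.conjExponent = p.conjExponent - 1 := by
      have : (p : ℝ) ≠ 0 := by linarith
      field_simp
      linarith
    rwa [h3] at h2
  have hR : 0 < 1 / (1 - α) := one_div_pos.2 (by linarith [hα.2])
  have hB : 0 < (1 / (1 - α)) ^ (p.conjExponent - 1) := Real.rpow_pos_of_pos hR _
  have h4 : M < M * (1 / (1 - α) * π) ^ (p.conjExponent - 1) := by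
    rw [Real.mul_rpow hR.le hπ0]
    have := mul_le_mul_of_nonneg_left h1 hB.le
    linarith
  have h5 : 1 < (1 / (1 - α) * π) ^ (p.conjExponent - 1) := by
    by_contra! h6
    have := mul_le_mul_of_nonneg_left h6 hM0
    linarith
  have h7 : 1 < 1 / (1 - α) * π := by
    by_contra! h8
    have := Real.rpow_le_one (mul_nonneg hR.le hπ0) h8 (by linarith : 0 ≤ p.conjExponent - 1)
    linarith
  rwa [one_div_mul_eq_div, lt_div_iff₀ (by linarith [hα.2]), one_mul] at h7

/-- If the tail probabilities of `Y` do not take values in `(0, 1 - α]`, then the normalized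
indicator of the set where `Y` is maximal is an optimal density. -/
lemma exists_isOptimalDensity_of_atom (hα : α ∈ Ioo (0 : ℝ) 1) (hp : 1 < p)
    (hYp : MemLp Y (ENNReal.ofReal p) P)
    (h : ∀ c, P {ω | c < Y ω} ≠ 0 → 1 - α < P.real {ω | c < Y ω}) :
    ∃ Z, IsOptimalDensity P p α Y Z := by
  have hq : 1 < p.conjExponent := one_lt_conjExponent hp
  have hYm := hYp.1.aemeasurable
  have hF : ∀ c, P {ω | c < Y ω} = 0 ∨ P.real {ω | Y ω ≤ c} < α := by
    intro c
    by_cases h0 : P {ω | c < Y ω} = 0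
    · exact Or.inl h0
    · right
      have := h c h0
      rw [survival_eq hYm] at this
      linarith
  have hF' : ∀ u ∈ Ioo α 1, ∀ c, u ≤ P.real {ω | Y ω ≤ c} ↔ P {ω | c < Y ω} = 0 := by
    intro u hu c
    constructor
    · intro huc
      exact (hF c).resolve_right (by linarith [hu.1])
    · intro h0
      have h1 : P.real {ω | c < Y ω} = 0 := (measureReal_eq_zero_iff).2 h0
      rw [survival_eq hYm] at h1
      linarith [hu.2]
  have hsub : ∀ u ∈ Ioo α 1, u ∈ Ioo (0 : ℝ) 1 := fun u hu => ⟨hα.1.trans hu.1, hu.2⟩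
  obtain ⟨u₀, hu₀⟩ : (Ioo α 1).Nonempty := nonempty_Ioo.2 hα.2
  set s := VaR P u₀ Y with hs
  -- The distribution function of Y takes no value in [α, 1) unless the tail is null, so the
  -- quantiles are constant on (α, 1). Their common value s is an atom of mass at least 1 - α and
  -- bounds Y almost everywhere.
  have hconst : ∀ u ∈ Ioo α 1, VaR P u Y = s := by
    intro u hu
    refine eq_of_forall_ge_iff fun t => ?_
    rw [VaR_le_iff hYm (hsub u hu), hs, VaR_le_iff hYm (hsub u₀ hu₀), hF' u hu, hF' u₀ hu₀]
  have hle : ∀ᵐ ω ∂P, Y ω ≤ s := by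
    have h1 := (hF' u₀ hu₀ s).1 ((VaR_le_iff hYm (hsub u₀ hu₀)).1 le_rfl)
    filter_upwards [compl_mem_ae_iff.2 h1] with ω hω
    exact not_lt.1 hω
  have hm : NullMeasurableSet {ω | Y ω = s} P := nullMeasurableSet_eq_fun hYm aemeasurable_const
  set S := {ω | Y ω = s} with hS
  have hπ : 1 - α ≤ P.real S := by
    have h1 : P.real S = (volume.restrict (Ioo (0 : ℝ) 1)).real {u | VaR P u Y = s} := by
      have h2 : P S = (P.map Y) {s} := by
        rw [Measure.map_apply_of_aemeasurable hYm (measurableSet_singleton s)]; rfl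
      rw [measureReal_def, h2, ← map_VaR hYm,
        Measure.map_apply_of_aemeasurable (aemeasurable_VaR hYm) (measurableSet_singleton s)]
      rfl
    have h3 : (volume.restrict (Ioo (0 : ℝ) 1)).real (Ioo α 1) = 1 - α := by
      rw [measureReal_restrict_apply measurableSet_Ioo,
        inter_eq_left.2 (fun u hu => hsub u hu), Real.volume_real_Ioo_of_le hα.2.le]
    rw [h1, ← h3]
    exact measureReal_mono hconst
  set π := P.real S with hπdef
  have hπ0 : 0 < π := lt_of_lt_of_le (by linarith [hα.2]) hπ
  set Z : Ω → ℝ := S.indicator fun _ => π⁻¹ with hZ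
  have hSint : ∀ a : ℝ, ∫ ω, S.indicator (fun _ => a) ω ∂P = π * a := by
    intro a
    rw [integral_indicator₀ hm]
    simp [hπdef]
  have hD : IsDensity P Z := by
    refine ⟨(integrable_const _).indicator₀ hm, Filter.Eventually.of_forall fun ω =>
      indicator_nonneg (fun _ _ => inv_nonneg.2 hπ0.le) ω, ?_⟩
    rw [hSint, mul_inv_cancel₀ hπ0.ne']
  have hpow : (fun ω => Z ω ^ p.conjExponent)
      = S.indicator fun _ => π⁻¹ ^ p.conjExponent := by
    ext ω
    by_cases hω : ω ∈ S
    · simp [hZ, hω]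
    · simp [hZ, hω, Real.zero_rpow (by linarith : p.conjExponent ≠ 0)]
  have hZq : Integrable (fun ω => Z ω ^ p.conjExponent) P := by
    rw [hpow]
    exact (integrable_const _).indicator₀ hm
  have hfeas : IsFeasibleDensity P p α Z := by
    rw [hD.isFeasibleDensity_iff hα.2 (Or.inl hp) hZq]
    refine ⟨fun _ => ?_, fun h => absurd h (by linarith)⟩
    rw [hpow, hSint]
    have h1 : π * π⁻¹ ^ p.conjExponent = π⁻¹ ^ (p.conjExponent - 1) := by
      rw [Real.rpow_sub_one (inv_ne_zero hπ0.ne')]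
      field_simp
    rw [h1]
    refine Real.rpow_le_rpow (inv_nonneg.2 hπ0.le) ?_ (by linarith)
    rw [one_div]
    exact inv_anti₀ (by linarith [hα.2]) hπ
  -- Z lives where Y is maximal, so the entropy constraint needs no multiplier.
  refine ⟨Z, hfeas.isOptimalDensity_of_multipliers ⟨hα.1.le, hα.2⟩ hp (Or.inl ⟨hp, hYp⟩)
    (c := s) (s := 0) le_rfl ?_ ?_ (by simp)⟩
  · filter_upwards [hle] with ω hω
    linarith
  · refine Filter.Eventually.of_forall fun ω => ?_
    by_cases hω : ω ∈ S
    · have : Y ω = s := hω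
      simp [this]
    · simp [hZ, hω]

/-- At α = 0 the q-th moment is at most 1 = (E Z) ^ q, so the equality case of strict Jensen leaves
only the constant density. -/
lemma isOptimalDensity_one (hp : 1 < p) (hY : HasMoment P p Y) :
    IsOptimalDensity P p 0 Y fun _ => 1 := by
  have h0 : (0 : ℝ) ∈ Ico (0 : ℝ) 1 := by simp
  have hq : 1 < p.conjExponent := one_lt_conjExponent hp
  refine (isFeasibleDensity_one p h0).isOptimalDensity h0 hY fun Z hZ => ?_
  have hD := hZ.isDensity
  have hb := ((hD.isFeasibleDensity_iff h0.2 (Or.inl hp) hZ.integrable_rpow).1 hZ).1 hp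
  rcases (strictConvexOn_rpow hq).ae_eq_const_or_map_average_lt
    (Real.continuous_rpow_const (by linarith)).continuousOn isClosed_Ici
    hD.nonneg hD.integrable hZ.integrable_rpow with h | h
  · rw [average_eq_integral, hD.integral_eq_one] at h
    exact (integral_congr_ae (h.mono fun ω hω => by simp [hω])).le
  · rw [average_eq_integral, average_eq_integral, hD.integral_eq_one] at h
    simp only [Real.one_rpow, sub_zero, div_one] at h hb
    linarith

theorem exists_isOptimalDensity (hα : α ∈ Ico (0 : ℝ) 1) (hp : 1 < p)
    (hYp : MemLp Y (ENNReal.ofReal p) P) : ∃ Z, IsOptimalDensity P p α Y Z := by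
  rcases hα.1.eq_or_lt with rfl | hα0
  · exact ⟨_, isOptimalDensity_one hp (Or.inl ⟨hp, hYp⟩)⟩
  · have hα' : α ∈ Ioo (0 : ℝ) 1 := ⟨hα0, hα.2⟩
    by_cases! h : ∃ c, P {ω | c < Y ω} ≠ 0 ∧
        (1 / (1 - α)) ^ (p.conjExponent - 1) *
          (∫ ω, truncationPath c 1 (Y ω) ^ (p - 1) ∂P) ^ p.conjExponent
        ≤ ∫ ω, truncationPath c 1 (Y ω) ^ p ∂P
    · obtain ⟨c, hc, h⟩ := h
      exact exists_isOptimalDensity_of_le hα' hp hYp hc h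
    · exact exists_isOptimalDensity_of_atom hα' hp hYp fun c hc =>
        measureReal_gt_of_lt hα' hp hYp (h c hc)

end Existence

end EntropicRisk

/-! ### The Kusuoka representation -/

theorem mainTheorem11 {Ω : Type*} [MeasurableSpace Ω] (P : Measure Ω) [IsProbabilityMeasure P]
    (p α : ℝ) (hα : α ∈ Ico (0 : ℝ) 1) (Y : Ω → ℝ)
    (hY : (1 < p ∧ MemLp Y (ENNReal.ofReal p) P) ∨ (p < 0 ∧ MemLp Y ⊤ P)) :
    -- the supremum that defines the Entropic Value-at-Risk is finite
    IsLUB (EntropicRisk.evarValues P p α Y) (EntropicRisk.EVaR P p α Y) ∧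
    -- the Kusuoka representation, with all its integrals well defined
    (∀ μ : Measure ℝ, EntropicRisk.IsAdmissible p α μ →
      Integrable (fun x => EntropicRisk.AVaR P x Y) μ) ∧
    IsLUB {r : ℝ | ∃ μ : Measure ℝ, EntropicRisk.IsAdmissible p α μ ∧
      r = ∫ x, EntropicRisk.AVaR P x Y ∂μ} (EntropicRisk.EVaR P p α Y) ∧
    -- for `p > 1` there is an optimal density
    (1 < p → ∃ Z : Ω → ℝ, EntropicRisk.IsOptimalDensity P p α Y Z) ∧
    -- the measure associated with the quantile function of an optimal density attains the supremum
    (∀ Z : Ω → ℝ, EntropicRisk.IsOptimalDensity P p α Y Z →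
      (∃! μ : Measure ℝ, EntropicRisk.IsAssociated P Z μ) ∧
      ∀ μ : Measure ℝ, EntropicRisk.IsAssociated P Z μ →
        EntropicRisk.IsAdmissible p α μ ∧
        ∫ x, EntropicRisk.AVaR P x Y ∂μ = EntropicRisk.EVaR P p α Y) := by
  have hY' : EntropicRisk.HasMoment P p Y := hY
  have hp := hY'.order
  have hlub := EntropicRisk.isLUB_EVaR hα hY'
  -- Serves both the lower bound in the representation and attainment; uniqueness reduces an
  -- arbitrary associated μ to the explicit `associatedMeasure`.
  have hkey : ∀ Z, EntropicRisk.IsFeasibleDensity P p α Z → ∀ μ, EntropicRisk.IsAssociated P Z μ →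
      EntropicRisk.IsAdmissible p α μ ∧
        ∫ ω, Y ω * Z ω ∂P ≤ ∫ x, EntropicRisk.AVaR P x Y ∂μ := by
    intro Z hZ μ hμ
    have hD := hZ.isDensity
    have hadm := hμ.isAdmissible hp hα.2 hZ
    refine ⟨hadm, ?_⟩
    have hA := hadm.integrable_AVaR hY'
    rw [hμ.unique hD.isAssociated_associatedMeasure] at hA ⊢
    exact hD.integral_mul_le_integral_AVaR hY'.integrable
      (hY'.integrable_mul hD.integrable hD.nonneg hZ.integrable_rpow) hA
  refine ⟨hlub, fun μ hμ => hμ.integrable_AVaR hY', ⟨?_, ?_⟩, ?_, ?_⟩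
  · rintro r ⟨μ, hμ, rfl⟩
    exact hμ.integral_AVaR_le_EVaR hα hY'
  · intro b hb
    refine hlub.2 ?_
    rintro r ⟨Z, hZ, rfl⟩
    obtain ⟨hadm, hle⟩ := hkey Z hZ _ hZ.isDensity.isAssociated_associatedMeasure
    exact hle.trans (hb ⟨_, hadm, rfl⟩)
  · intro h1p
    rcases hY with ⟨-, hYp⟩ | ⟨hpneg, -⟩
    · exact EntropicRisk.exists_isOptimalDensity hα h1p hYp
    · linarith
  · rintro Z ⟨hZ, hopt⟩
    refine ⟨⟨_, hZ.isDensity.isAssociated_associatedMeasure,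
      fun ν hν => hν.unique hZ.isDensity.isAssociated_associatedMeasure⟩, fun μ hμ => ?_⟩
    obtain ⟨hadm, hle⟩ := hkey Z hZ μ hμ
    exact ⟨hadm, le_antisymm (hadm.integral_AVaR_le_EVaR hα hY') (hopt ▸ hle)⟩
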